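/- Let $V=\mathbb{C}^2$ be the standard representation of $\mathrm{SL}(2,\mathbb{C})$. Identify $\mathbb{P}V=\mathbb{CP}^1$ with the unit sphere in $\mathbb{R}^3$ by stereographic projection, and identify $\mathbb{P}(S^dV)$ with the space $\operatorname{Sym}^d\mathbb{CP}^1$ of unordered $d$-tuples of points of $\mathbb{CP}^1$, by factorising binary forms of degree $d$. Let $C$ be the set of vertices of an equilateral triangle on a great circle of the sphere ($d=3$), or of a regular tetrahedron ($d=4$), octahedron ($d=6$) or icosahedron ($d=12$) inscribed in the sphere. Let $W_C\subset\mathbb{P}(S^dV)$ be the $\mathrm{SL}(2,\mathbb{C})$-orbit of $C$, let $X_C=\overline{W_C}$ be its closure (which is a smooth projective threefold), and let $L_C\subset W_C$ be the $\mathrm{SU}(2)$-orbit of $C$. For $A\in\mathrm{SL}(2,\mathbb{C})$ write $A^\ddag=(\overline{A}^{\,T})^{-1}$. Then: (0) The rule $\tau(A\cdot C)=A^\ddag\cdot C$ for $A\in\mathrm{SL}(2,\mathbb{C})$ gives a well-defined map $\tau\colon W_C\to W_C$. (1) Let $U\subset\mathbb{C}$ be an open neighbourhood of $0$ and let $u\colon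 U\to X_C$ be a holomorphic map with $u(U\setminus\{0\})\subset W_C$. Then $\tau\circ u|_{U\setminus\{0\}}$ extends to a continuous map $U\to X_C$. (2) Let $D=\{z\in\mathbb{C}:|z|\le 1\}$ and let $u\colon(D,\partial D)\to(X_C,L_C)$ be a holomorphic disc, that is, a continuous map $u\colon D\to X_C$ with $u(\partial D)\subset L_C$ that is holomorphic in the interior of $D$. Then there is a holomorphic map $\tilde u\colon\mathbb{CP}^1=\mathbb{C}\cup\{\infty\}\to X_C$ with $\tilde u(z)=u(z)$ for all $z\in D$ and $\tilde u(1/\overline z)=\tau(u(z))$ for all $z\in D$ with $u(z)\in W_C$ (where $1/\overline{0}=\infty$). -/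

import Mathlib

open scoped LinearAlgebra.Projectivization Topology

noncomputable section

namespace PlatonicLagrangian

/-! ## Complex projective space and holomorphic maps into it -/

/-- The standard (quotient) topology on a complex projective space. -/
instance projTopology {n : ℕ} : TopologicalSpace (ℙ ℂ (Fin n → ℂ)) :=
  TopologicalSpace.coinduced
    (fun v : {v : Fin n → ℂ // v ≠ 0} => Projectivization.mk ℂ v.1 v.2) inferInstance

/-- A map to projective space is holomorphic near `z` if on a neighbourhood of `z` it is given in
homogeneous coordinates by holomorphic functions without common zeros. -/
def HolomorphicNear {n : ℕ} (f : ℂ → ℙ ℂ (Fin n → ℂ)) (z : ℂ) : Prop :=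
  ∃ F : ℂ → Fin n → ℂ, ∀ᶠ y in 𝓝 z,
    DifferentiableAt ℂ F y ∧ ∃ h : F y ≠ 0, f y = Projectivization.mk ℂ (F y) h

/-- Holomorphy on an open set `U`. -/
def HolomorphicOnOpen {n : ℕ} (f : ℂ → ℙ ℂ (Fin n → ℂ)) (U : Set ℂ) : Prop :=
  ∀ z ∈ U, HolomorphicNear f z

open scoped Classical in
/-- Holomorphy of a map from the Riemann sphere `ℂ ∪ {∞}`: it is holomorphic in each of the two
standard charts, with coordinates `z` and `1 / z`. -/
def HolomorphicSphere {n : ℕ} (f : OnePoint ℂ → ℙ ℂ (Fin n → ℂ)) : Prop :=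
  HolomorphicOnOpen (fun z : ℂ => f (z : OnePoint ℂ)) Set.univ ∧
  HolomorphicOnOpen
    (fun z : ℂ => f (if z = 0 then OnePoint.infty else ((z⁻¹ : ℂ) : OnePoint ℂ))) Set.univ

open scoped Classical in
/-- The reflection `z ↦ 1 / conj z` from the plane to the Riemann sphere. -/
def reflect (z : ℂ) : OnePoint ℂ :=
  if z = 0 then OnePoint.infty else (((starRingEnd ℂ z)⁻¹ : ℂ) : OnePoint ℂ)

/-! ## Configurations of points on the projective line as binary forms

`V = ℂ²` has basis `x, y`. The form `∑ j, z j * x ^ (d - j) * y ^ j` in `S^d V` has standard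
coordinates `z : Fin (d + 1) → ℂ`. -/

/-- The product `∏ (a i * x + b i * y)` of the linear forms `v i = (a i, b i)`, with `x` set equal
to `1` and `y = X`: the coefficient of `X ^ j` is that of `x ^ (d - j) * y ^ j`. -/
def formPoly {d : ℕ} (v : Fin d → Fin 2 → ℂ) : Polynomial ℂ :=
  ∏ i, (Polynomial.C (v i 0) + Polynomial.C (v i 1) * Polynomial.X)

/-- Standard coordinates on `S^d V` of the product of the linear forms `v i`. -/
def formCoords {d : ℕ} (v : Fin d → Fin 2 → ℂ) : Fin (d + 1) → ℂ :=
  fun j => (formPoly v).coeff j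

theorem formCoords_ne_zero {d : ℕ} (v : Fin d → Fin 2 → ℂ) (hv : ∀ i, v i ≠ 0) :
    formCoords v ≠ 0 := by
  intro h
  have hdeg : (formPoly v).natDegree ≤ d := by
    refine (Polynomial.natDegree_prod_le _ _).trans ?_
    refine (Finset.sum_le_card_nsmul _ _ 1 fun i _ => ?_).trans (by simp)
    rw [add_comm]
    exact Polynomial.natDegree_linear_le
  have h0 : formPoly v = 0 := by
    ext j
    by_cases hj : j < d + 1
    · exact congrFun h ⟨j, hj⟩
    · rw [Polynomial.coeff_zero]
      exact Polynomial.coeff_eq_zero_of_natDegree_lt (by omega)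
  obtain ⟨i, -, hi⟩ := Finset.prod_eq_zero_iff.mp h0
  apply hv i
  have e0 := congrArg (fun p => Polynomial.coeff p 0) hi
  have e1 := congrArg (fun p => Polynomial.coeff p 1) hi
  simp at e0 e1
  funext k
  fin_cases k
  · exact e0
  · exact e1

/-- The identification of unordered `d`-tuples of points of `ℙ V` with points of `ℙ (S^d V)`:
the tuple `[v 1], …, [v d]` goes to `[v 1 * ⋯ * v d]`. -/
def symPoint {d : ℕ} (p : Fin d → ℙ ℂ (Fin 2 → ℂ)) : ℙ ℂ (Fin (d + 1) → ℂ) :=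
  Projectivization.mk ℂ (formCoords fun i => (p i).rep)
    (formCoords_ne_zero _ fun i => (p i).rep_nonzero)

/-- `symPoint` does not depend on the vectors that represent the points. -/
theorem symPoint_mk {d : ℕ} (v : Fin d → Fin 2 → ℂ) (hv : ∀ i, v i ≠ 0) :
    symPoint (fun i => Projectivization.mk ℂ (v i) (hv i)) =
      Projectivization.mk ℂ (formCoords v) (formCoords_ne_zero v hv) := by
  have h : ∀ i, ∃ a : ℂˣ, a • v i = (Projectivization.mk ℂ (v i) (hv i)).rep :=
    fun i => Projectivization.exists_smul_eq_mk_rep ℂ (v i) (hv i)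
  choose a ha using h
  refine (Projectivization.mk_eq_mk_iff' ℂ _ _ _ _).2 ⟨∏ i, (a i : ℂ), ?_⟩
  have hp : formPoly (fun i => (Projectivization.mk ℂ (v i) (hv i)).rep)
      = Polynomial.C (∏ i, (a i : ℂ)) * formPoly v := by
    unfold formPoly
    rw [map_prod, ← Finset.prod_mul_distrib]
    refine Finset.prod_congr rfl fun i _ => ?_
    simp only [← ha i]
    simp [Units.smul_def, mul_add, mul_assoc]
  funext j
  simp only [formCoords, hp, Polynomial.coeff_C_mul, Pi.smul_apply, smul_eq_mul]

/-! ## The configurations -/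

/-- The four types of configuration. -/
inductive Shape
  | triangle
  | tetrahedron
  | octahedron
  | icosahedron

/-- The number of vertices. -/
def Shape.card : Shape → ℕ
  | .triangle => 3
  | .tetrahedron => 4
  | .octahedron => 6
  | .icosahedron => 12

/-- Vertices of an equilateral triangle in a plane through the origin, and of a regular
tetrahedron, octahedron and icosahedron, all centred at the origin (not normalised to lie on the
unit sphere). -/
def Shape.rawVertex : (s : Shape) → Fin s.card → EuclideanSpace ℝ (Fin 3)
  | .triangle => ![!₂[2, 0, 0], !₂[-1, √3, 0], !₂[-1, -√3, 0]]
  | .tetrahedron => ![!₂[1, 1, 1], !₂[1, -1, -1], !₂[-1, 1, -1], !₂[-1, -1, 1]]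
  | .octahedron =>
      ![!₂[1, 0, 0], !₂[-1, 0, 0], !₂[0, 1, 0], !₂[0, -1, 0], !₂[0, 0, 1], !₂[0, 0, -1]]
  | .icosahedron =>
      ![!₂[0, 1, Real.goldenRatio], !₂[0, 1, -Real.goldenRatio],
        !₂[0, -1, Real.goldenRatio], !₂[0, -1, -Real.goldenRatio],
        !₂[1, Real.goldenRatio, 0], !₂[1, -Real.goldenRatio, 0],
        !₂[-1, Real.goldenRatio, 0], !₂[-1, -Real.goldenRatio, 0],
        !₂[Real.goldenRatio, 0, 1], !₂[-Real.goldenRatio, 0, 1],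
        !₂[Real.goldenRatio, 0, -1], !₂[-Real.goldenRatio, 0, -1]]

/-- The vertices on the unit sphere. -/
def Shape.vertex (s : Shape) (i : Fin s.card) : EuclideanSpace ℝ (Fin 3) :=
  (‖s.rawVertex i‖⁻¹ : ℝ) • s.rawVertex i

/-- Homogeneous coordinates of the stereographic projection `(p 0 + i * p 1) / (1 - p 2)` from the
north pole `(0, 0, 1)`, which itself goes to `∞ = [1 : 0]`. -/
def stereoVec (p : EuclideanSpace ℝ (Fin 3)) : Fin 2 → ℂ :=
  if p 2 = 1 then ![1, 0] else ![(p 0 : ℂ) + Complex.I * (p 1 : ℂ), 1 - (p 2 : ℂ)]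

theorem stereoVec_ne_zero (p : EuclideanSpace ℝ (Fin 3)) : stereoVec p ≠ 0 := by
  intro h
  unfold stereoVec at h
  split_ifs at h with hp
  · simpa using congrFun h 0
  · have h1 : (1 : ℂ) - (p 2 : ℂ) = 0 := by simpa using congrFun h 1
    apply hp
    exact_mod_cast (sub_eq_zero.mp h1).symm

/-- The point of `ℙ V` that corresponds to a point of the unit sphere in `ℝ³`. -/
def stereo (p : EuclideanSpace ℝ (Fin 3)) : ℙ ℂ (Fin 2 → ℂ) :=
  Projectivization.mk ℂ (stereoVec p) (stereoVec_ne_zero p)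

/-- The configuration of shape `s` in the position on the sphere given by the orthogonal map `g`:
as `g` varies, these are all equilateral triangles on great circles, and all regular
tetrahedra, octahedra and icosahedra inscribed in the sphere. -/
def config (s : Shape) (g : EuclideanSpace ℝ (Fin 3) ≃ₗᵢ[ℝ] EuclideanSpace ℝ (Fin 3)) :
    Fin s.card → ℙ ℂ (Fin 2 → ℂ) :=
  fun i => stereo (g (s.vertex i))

/-! ## Orbits of a configuration and the involution

Here `SL(2, ℂ)` acts on `ℙ V` in the usual way, and on configurations pointwise. -/

/-- The point `A · C` of `ℙ (S^d V)`. -/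
def orbitPoint {d : ℕ} (C : Fin d → ℙ ℂ (Fin 2 → ℂ)) (A : Matrix.SpecialLinearGroup (Fin 2) ℂ) :
    ℙ ℂ (Fin (d + 1) → ℂ) :=
  symPoint fun i => A • C i

/-- The `SL(2, ℂ)`-orbit `W_C` of `C`. -/
def openOrbit {d : ℕ} (C : Fin d → ℙ ℂ (Fin 2 → ℂ)) : Set (ℙ ℂ (Fin (d + 1) → ℂ)) :=
  Set.range (orbitPoint C)

/-- The orbit closure `X_C`. -/
def orbitClosure {d : ℕ} (C : Fin d → ℙ ℂ (Fin 2 → ℂ)) : Set (ℙ ℂ (Fin (d + 1) → ℂ)) :=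
  closure (openOrbit C)

/-- The `SU(2)`-orbit `L_C` of `C`. -/
def lagrangian {d : ℕ} (C : Fin d → ℙ ℂ (Fin 2 → ℂ)) : Set (ℙ ℂ (Fin (d + 1) → ℂ)) :=
  {p | ∃ A : Matrix.SpecialLinearGroup (Fin 2) ℂ,
    (A : Matrix (Fin 2) (Fin 2) ℂ) ∈ Matrix.specialUnitaryGroup (Fin 2) ℂ ∧ p = orbitPoint C A}

/-- Conjugate-transpose-inverse on `SL(2, ℂ)`. -/
def ddag (A : Matrix.SpecialLinearGroup (Fin 2) ℂ) : Matrix.SpecialLinearGroup (Fin 2) ℂ :=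
  ⟨(A⁻¹ : Matrix.SpecialLinearGroup (Fin 2) ℂ).1.conjTranspose, by
    rw [Matrix.det_conjTranspose, (A⁻¹).2, star_one]⟩

open scoped Classical in
/-- The involution `τ` of `W_C`, `A · C ↦ A^‡ · C`. (Outside `W_C` the value `p` is a dummy;
that the choice of `A` does not matter is a part of the theorem.) -/
def tau {d : ℕ} (C : Fin d → ℙ ℂ (Fin 2 → ℂ)) (p : ℙ ℂ (Fin (d + 1) → ℂ)) :
    ℙ ℂ (Fin (d + 1) → ℂ) :=
  if h : ∃ A, orbitPoint C A = p then orbitPoint C (ddag h.choose) else p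

/-- A holomorphic disc `(D, ∂D) → (X_C, L_C)`: continuous on the closed unit disc `D` and
holomorphic on its interior. -/
structure IsHolomorphicDisc {d : ℕ} (C : Fin d → ℙ ℂ (Fin 2 → ℂ))
    (u : ℂ → ℙ ℂ (Fin (d + 1) → ℂ)) : Prop where
  continuousOn : ContinuousOn u (Metric.closedBall 0 1)
  holomorphic : HolomorphicOnOpen u (Metric.ball 0 1)
  mapsTo : Set.MapsTo u (Metric.closedBall 0 1) (orbitClosure C)
  boundary : Set.MapsTo u (Metric.sphere 0 1) (lagrangian C)

end PlatonicLagrangian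

end

noncomputable section

namespace PlatonicLagrangian

/-! ## Removability of lines and circles for continuous functions -/

/-! On `W_C` the involution is given in homogeneous coordinates by the complex conjugate of a
homogeneous holomorphic map `Φ` with no zeros over `W_C`; this is `IsTauLift`. Everything follows
from such a `Φ`.

Since `[conj Φ]` depends only on the point, `τ` is well defined. If `F` lifts a holomorphic curve
through `z` and `Φ ∘ F` is not identically zero near `z`, then `Φ (F y) = (y - z) ^ n • G y` with `G
z ≠ 0`, and `[conj G]` extends `τ ∘ u` over `z` (`exists_extension`); the extension stays in `X_C`
because `X_C` is closed. For a disc, `Φ` does not vanish over the boundary, so by the identity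
principle its zeros in the interior are isolated and `τ ∘ u` extends to an antiholomorphic disc.
Precomposed with `z ↦ 1 / conj z` it continues `u` beyond the circle. The two halves agree on the
circle because `τ` fixes `L_C`, and a continuous map that is holomorphic off the circle is
holomorphic by Morera's theorem.

To construct `Φ`, let `J` be the quaternionic structure on `ℂ²`. Then `A^‡ = -J A J`, so `A^‡ · C =
J (A · J C)`, where `J C` is the antipodal configuration. As `J` acts on forms by a conjugate-linear
coordinate map, it suffices to find a polynomial map that takes the form of `A · C` to a nonzero
multiple of the form of `A · J C`. The octahedron and the icosahedron are their own antipodes, so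
the identity works. For the triangle and the tetrahedron classical covariants work: the cubic
covariant and the Hessian. With `l = A v₀` and `m = A J v₀`, the forms become `l (l² - c m²)` and `l
(l³ + e m³)`, and the covariant exchanges `l` and `m`. The identities hold for arbitrary `l, m`,
which makes a separate proof of equivariance unnecessary. The geometry enters only through the
coefficients in the frame `v₀, J v₀`, computed by `exists_stereoVec_decomposition`. -/

open Complex in
/-- A continuous function that is holomorphic off the real line has vanishing integrals over the
boundaries of rectangles. -/
theorem isConservativeOn_of_differentiableAt_off_real {E : Type*} [NormedAddCommGroup E]
    [NormedSpace ℂ E] {f : ℂ → E} {U : Set ℂ} (hf : ContinuousOn f U)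
    (hd : ∀ z ∈ U, z.im ≠ 0 → DifferentiableAt ℂ f z) : IsConservativeOn f U := by
  intro z w hzw
  rw [← add_eq_zero_iff_eq_neg, wedgeIntegral_add_wedgeIntegral_eq]
  -- Cut the rectangle at height `b = 0` if it meets the real axis, and otherwise at `b = z.im`,
  -- which makes one piece degenerate. Neither open piece then meets the axis, so Cauchy's theorem,
  -- which needs only continuity on the boundary, applies to both.
  obtain ⟨b, hb, hb1, hb2⟩ : ∃ b ∈ Set.uIcc z.im w.im,
      (0 : ℝ) ∉ Set.Ioo (min z.im b) (max z.im b) ∧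
      (0 : ℝ) ∉ Set.Ioo (min b w.im) (max b w.im) := by
    by_cases h : (0 : ℝ) ∈ Set.uIcc z.im w.im
    · refine ⟨0, h, ?_, ?_⟩ <;> · rintro ⟨h1, h2⟩; simp at h1 h2; linarith
    · refine ⟨z.im, Set.left_mem_uIcc, by simp, fun h' => h (Set.Ioo_subset_Icc_self h')⟩
  have hre : ∀ y ∈ Set.uIcc z.im w.im, ∀ x ∈ Set.uIcc z.re w.re, (x + y * I : ℂ) ∈ U := by
    intro y hy x hx
    apply hzw
    simp [Rectangle, mem_reProdIm, hx, hy]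
  have sub1 : Set.uIcc z.im b ⊆ Set.uIcc z.im w.im := Set.uIcc_subset_uIcc_left hb
  have sub2 : Set.uIcc b w.im ⊆ Set.uIcc z.im w.im := Set.uIcc_subset_uIcc_right hb
  have key : ∀ y1 y2 : ℝ, Set.uIcc y1 y2 ⊆ Set.uIcc z.im w.im →
      (0 : ℝ) ∉ Set.Ioo (min y1 y2) (max y1 y2) →
      (∫ x : ℝ in z.re..w.re, f (x + y1 * I)) - (∫ x : ℝ in z.re..w.re, f (x + y2 * I)) +
        I • (∫ y : ℝ in y1..y2, f (w.re + y * I)) -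
        I • (∫ y : ℝ in y1..y2, f (z.re + y * I)) = 0 := by
    intro y1 y2 hs h0
    have hR : ∀ p : ℂ, p ∈ Set.uIcc z.re w.re ×ℂ Set.uIcc y1 y2 → p ∈ U := by
      intro p hp
      have := hre p.im (hs hp.2) p.re hp.1
      rwa [re_add_im] at this
    have := integral_boundary_rect_eq_zero_of_continuousOn_of_differentiableOn f
      (z.re + y1 * I) (w.re + y2 * I) (by
        simp only [add_re, ofReal_re, mul_re, I_re, mul_zero, ofReal_im, I_im, mul_one, sub_self,
          add_zero, add_im, mul_im, zero_add]
        exact hf.mono hR) (by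
        simp only [add_re, ofReal_re, mul_re, I_re, mul_zero, ofReal_im, I_im, mul_one, sub_self,
          add_zero, add_im, mul_im, zero_add]
        intro p hp
        refine (hd p (hR p ⟨Set.Ioo_subset_Icc_self hp.1, Set.Ioo_subset_Icc_self hp.2⟩)
          fun h => h0 ?_).differentiableWithinAt
        rw [← h]; exact hp.2)
    simpa using this
  have hint : ∀ x ∈ Set.uIcc z.re w.re, ∀ y1 y2 : ℝ, Set.uIcc y1 y2 ⊆ Set.uIcc z.im w.im →
      IntervalIntegrable (fun y : ℝ => f (x + y * I)) MeasureTheory.volume y1 y2 := by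
    intro x hx y1 y2 hs
    apply ContinuousOn.intervalIntegrable
    exact hf.comp (by fun_prop) fun y hy => hre y (hs hy) x hx
  have k1 := key z.im b sub1 hb1
  have k2 := key b w.im sub2 hb2
  rw [← intervalIntegral.integral_add_adjacent_intervals
      (hint w.re Set.right_mem_uIcc z.im b sub1) (hint w.re Set.right_mem_uIcc b w.im sub2),
    ← intervalIntegral.integral_add_adjacent_intervals
      (hint z.re Set.left_mem_uIcc z.im b sub1) (hint z.re Set.left_mem_uIcc b w.im sub2),
    smul_add, smul_add]
  rw [← add_zero (0 : E)]
  nth_rewrite 1 [← k1]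
  rw [← k2]
  abel

/-- A continuous function that is holomorphic off the real line is holomorphic. -/
theorem differentiableAt_of_continuous_of_off_real {E : Type*} [NormedAddCommGroup E]
    [NormedSpace ℂ E] [CompleteSpace E] {f : ℂ → E} {z₀ : ℂ}
    (h : ∀ᶠ z in 𝓝 z₀, ContinuousAt f z ∧ (z.im ≠ 0 → DifferentiableAt ℂ f z)) :
    DifferentiableAt ℂ f z₀ := by
  obtain ⟨r, hr, hball⟩ := Metric.eventually_nhds_iff_ball.1 h
  have hc : ContinuousOn f (Metric.ball z₀ r) := fun z hz => (hball z hz).1.continuousWithinAt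
  -- Morera: vanishing rectangle integrals give a primitive on the ball, and derivatives of
  -- holomorphic functions are holomorphic.
  have := ((isConservativeOn_of_differentiableAt_off_real hc
    fun z hz => (hball z hz).2).isExactOn_ball hc).differentiableOn Metric.isOpen_ball
  exact this.differentiableAt (Metric.ball_mem_nhds z₀ hr)

/-- A continuous function that is holomorphic off the unit circle is holomorphic. -/
theorem differentiableAt_of_continuous_of_off_circle {E : Type*} [NormedAddCommGroup E]
    [NormedSpace ℂ E] [CompleteSpace E] {f : ℂ → E} {z₀ : ℂ} (hz₀ : ‖z₀‖ = 1)
    (h : ∀ᶠ z in 𝓝 z₀, ContinuousAt f z ∧ (‖z‖ ≠ 1 → DifferentiableAt ℂ f z)) :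
    DifferentiableAt ℂ f z₀ := by
  have hz0 : z₀ ≠ 0 := by rintro rfl; simp at hz₀
  -- Since `‖e ζ‖ = exp (-ζ.im)`, this straightens the circle to the real axis; `l` below is its
  -- local inverse at `z₀`.
  set e : ℂ → ℂ := fun ζ => z₀ * Complex.exp (Complex.I * ζ) with he
  have he0 : e 0 = z₀ := by simp [he]
  have hed : Differentiable ℂ e := by fun_prop
  have hnorm : ∀ ζ, ‖e ζ‖ = 1 → ζ.im = 0 := by
    intro ζ h
    simpa [he, hz₀, Complex.norm_exp] using h
  have hg : DifferentiableAt ℂ (f ∘ e) 0 := by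
    apply differentiableAt_of_continuous_of_off_real
    have ht : Filter.Tendsto e (𝓝 0) (𝓝 z₀) := by
      have := hed.continuous.tendsto 0
      rwa [he0] at this
    filter_upwards [ht.eventually h] with ζ hζ
    refine ⟨hζ.1.comp hed.continuous.continuousAt, fun hi => ?_⟩
    exact (hζ.2 fun h1 => hi (hnorm ζ h1)).comp ζ (hed ζ)
  set l : ℂ → ℂ := fun z => -Complex.I * Complex.log (z / z₀) with hl
  have hl0 : l z₀ = 0 := by simp [hl, hz0]
  have hld : DifferentiableAt ℂ l z₀ := by
    refine (DifferentiableAt.clog (by fun_prop) ?_).const_mul _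
    rw [div_self hz0]
    simp
  have : DifferentiableAt ℂ ((f ∘ e) ∘ l) z₀ := by
    apply DifferentiableAt.comp _ _ hld
    rwa [hl0]
  refine this.congr_of_eventuallyEq ?_
  filter_upwards [isOpen_ne.mem_nhds hz0] with z hz
  have : e (l z) = z := by
    have h1 : Complex.I * (-Complex.I * Complex.log (z / z₀)) = Complex.log (z / z₀) := by
      rw [← mul_assoc]; simp
    simp only [he, hl, h1]
    rw [Complex.exp_log (div_ne_zero hz hz0)]
    field_simp
  simp [this]

/-! ## Topology of projective space -/

theorem isOpenQuotientMap_projectivization_mk {n : ℕ} : IsOpenQuotientMap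
    (fun v : {v : Fin n → ℂ // v ≠ 0} => Projectivization.mk ℂ v.1 v.2) := by
  refine IsOpenQuotientMap.of_isOpenMap_isQuotientMap ?_
    ⟨⟨rfl⟩, fun p => ⟨⟨p.rep, p.rep_nonzero⟩, p.mk_rep⟩⟩
  intro O hO
  rw [isOpen_coinduced]
  -- The saturation of `O` is the union of its preimages under all nonzero scalings, hence open.
  have : (fun v : {v : Fin n → ℂ // v ≠ 0} => Projectivization.mk ℂ v.1 v.2) ⁻¹'
      ((fun v : {v : Fin n → ℂ // v ≠ 0} => Projectivization.mk ℂ v.1 v.2) '' O) =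
      ⋃ a : ℂˣ, (fun v : {v : Fin n → ℂ // v ≠ 0} =>
        (⟨a • v.1, (smul_ne_zero_iff_ne a).2 v.2⟩ : {v : Fin n → ℂ // v ≠ 0})) ⁻¹' O := by
    ext v
    simp only [Set.mem_preimage, Set.mem_image, Set.mem_iUnion]
    constructor
    · rintro ⟨x, hx, h⟩
      obtain ⟨a, ha⟩ := (Projectivization.mk_eq_mk_iff ℂ _ _ _ _).1 h
      refine ⟨a, ?_⟩
      convert hx
    · rintro ⟨a, ha⟩
      exact ⟨_, ha, (Projectivization.mk_eq_mk_iff ℂ _ _ _ _).2 ⟨a, rfl⟩⟩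
  rw [this]
  refine isOpen_iUnion fun a => hO.preimage ?_
  refine Continuous.subtype_mk ?_ _
  exact continuous_subtype_val.const_smul (a : ℂ)

open scoped Classical in
/-- The point of projective space with given homogeneous coordinates (a dummy value at `0`). -/
def homPt {d : ℕ} (v : Fin (d + 1) → ℂ) : ℙ ℂ (Fin (d + 1) → ℂ) :=
  if h : v ≠ 0 then Projectivization.mk ℂ v h
  else Projectivization.mk ℂ (fun _ => 1) fun h => one_ne_zero (congrFun h 0)

theorem homPt_of_ne_zero {d : ℕ} {v : Fin (d + 1) → ℂ} (h : v ≠ 0) :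
    homPt v = Projectivization.mk ℂ v h := dif_pos h

theorem homPt_rep {d : ℕ} (p : ℙ ℂ (Fin (d + 1) → ℂ)) : homPt p.rep = p := by
  rw [homPt_of_ne_zero p.rep_nonzero, p.mk_rep]

theorem homPt_smul {d : ℕ} {a : ℂ} (ha : a ≠ 0) (v : Fin (d + 1) → ℂ) :
    homPt (a • v) = homPt v := by
  by_cases hv : v = 0
  · simp [hv]
  · rw [homPt_of_ne_zero hv, homPt_of_ne_zero (smul_ne_zero ha hv)]
    exact (Projectivization.mk_eq_mk_iff' ℂ _ _ _ _).2 ⟨a, rfl⟩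

theorem exists_rep_homPt {d : ℕ} {v : Fin (d + 1) → ℂ} (hv : v ≠ 0) :
    ∃ a : ℂ, a ≠ 0 ∧ (homPt v).rep = a • v := by
  rw [homPt_of_ne_zero hv]
  obtain ⟨a, ha⟩ := Projectivization.exists_smul_eq_mk_rep ℂ v hv
  exact ⟨a, a.ne_zero, ha.symm⟩

/-- Because the projection is an open quotient map, pointwise continuity can be tested on
homogeneous coordinates. -/
theorem continuousAt_comp_homPt {d : ℕ} {Y : Type*} [TopologicalSpace Y]
    {f : ℙ ℂ (Fin (d + 1) → ℂ) → Y} {v : Fin (d + 1) → ℂ} (hv : v ≠ 0) :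
    ContinuousAt f (homPt v) ↔ ContinuousAt (fun x => f (homPt x)) v := by
  rw [homPt_of_ne_zero hv]
  rw [← isOpenQuotientMap_projectivization_mk.continuousAt_comp_iff (x := ⟨v, hv⟩)]
  have hopen : IsOpen {v : Fin (d + 1) → ℂ | v ≠ 0} := isOpen_ne
  rw [← hopen.isOpenEmbedding_subtypeVal.continuousAt_iff (x := ⟨v, hv⟩)]
  have : (f ∘ fun v : {v : Fin (d + 1) → ℂ // v ≠ 0} => Projectivization.mk ℂ v.1 v.2) =
      (fun x => f (homPt x)) ∘ Subtype.val := by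
    funext x
    simp [homPt_of_ne_zero x.2]
  rw [this]
  rfl

theorem continuousAt_homPt {d : ℕ} {v : Fin (d + 1) → ℂ} (hv : v ≠ 0) :
    ContinuousAt homPt v := (continuousAt_comp_homPt (f := id) hv).1 continuousAt_id

/-! ## Holomorphic maps to projective space -/

/-- An analytic lift is what allows powers of `y - z` to be factored out later. -/
theorem holomorphicNear_iff {d : ℕ} {f : ℂ → ℙ ℂ (Fin (d + 1) → ℂ)} {z : ℂ} :
    HolomorphicNear f z ↔ ∃ F : ℂ → Fin (d + 1) → ℂ,
      AnalyticAt ℂ F z ∧ F z ≠ 0 ∧ ∀ᶠ y in 𝓝 z, f y = homPt (F y) := by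
  constructor
  · rintro ⟨F, hF⟩
    refine ⟨F, Complex.analyticAt_iff_eventually_differentiableAt.2 (hF.mono fun y h => h.1),
      hF.self_of_nhds.2.1, hF.mono fun y h => ?_⟩
    rw [h.2.2, homPt_of_ne_zero]
  · rintro ⟨F, hF, h0, h⟩
    refine ⟨F, ?_⟩
    filter_upwards [Complex.analyticAt_iff_eventually_differentiableAt.1 hF, h,
      hF.continuousAt.eventually_ne h0] with y h1 h2 h3
    exact ⟨h1, h3, by rw [h2, homPt_of_ne_zero]⟩

theorem HolomorphicNear.continuousAt {d : ℕ} {f : ℂ → ℙ ℂ (Fin (d + 1) → ℂ)} {z : ℂ}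
    (h : HolomorphicNear f z) : ContinuousAt f z := by
  obtain ⟨F, hF, h0, h⟩ := holomorphicNear_iff.1 h
  exact ((continuousAt_homPt h0).comp hF.continuousAt).congr (h.mono fun y hy => hy.symm)

theorem HolomorphicNear.congr {d : ℕ} {f g : ℂ → ℙ ℂ (Fin (d + 1) → ℂ)} {z : ℂ}
    (h : HolomorphicNear f z) (hfg : ∀ᶠ y in 𝓝 z, g y = f y) : HolomorphicNear g z := by
  obtain ⟨F, hF, h0, h⟩ := holomorphicNear_iff.1 h
  refine holomorphicNear_iff.2 ⟨F, hF, h0, ?_⟩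
  filter_upwards [h, hfg] with y h1 h2
  rw [h2, h1]

theorem HolomorphicNear.comp {d : ℕ} {f : ℂ → ℙ ℂ (Fin (d + 1) → ℂ)} {φ : ℂ → ℂ} {z : ℂ}
    (h : HolomorphicNear f (φ z)) (hφ : AnalyticAt ℂ φ z) :
    HolomorphicNear (fun y => f (φ y)) z := by
  obtain ⟨F, hF, h0, h⟩ := holomorphicNear_iff.1 h
  exact holomorphicNear_iff.2 ⟨F ∘ φ, hF.comp hφ, h0, hφ.continuousAt.eventually h⟩

/-- Affine coordinates in the chart where the `k`-th homogeneous coordinate is not zero. -/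
def affineCoords {d : ℕ} (k : Fin (d + 1)) (p : ℙ ℂ (Fin (d + 1) → ℂ)) : Fin (d + 1) → ℂ :=
  (p.rep k)⁻¹ • p.rep

theorem affineCoords_homPt {d : ℕ} (k : Fin (d + 1)) {v : Fin (d + 1) → ℂ} (hv : v ≠ 0) :
    affineCoords k (homPt v) = (v k)⁻¹ • v := by
  obtain ⟨a, ha, h⟩ := exists_rep_homPt hv
  rw [affineCoords, h]
  funext i
  simp
  field_simp

theorem rep_homPt_apply_eq_zero {d : ℕ} (k : Fin (d + 1)) {v : Fin (d + 1) → ℂ} (hv : v ≠ 0) :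
    (homPt v).rep k = 0 ↔ v k = 0 := by
  obtain ⟨a, ha, h⟩ := exists_rep_homPt hv
  simp [h, ha]

theorem eventually_homPt {d : ℕ} {P : ℙ ℂ (Fin (d + 1) → ℂ) → Prop} {v : Fin (d + 1) → ℂ}
    (hv : v ≠ 0) (h : ∀ᶠ x in 𝓝 v, P (homPt x)) : ∀ᶠ p in 𝓝 (homPt v), P p := by
  rw [homPt_of_ne_zero hv]
  rw [← isOpenQuotientMap_projectivization_mk.map_nhds_eq ⟨v, hv⟩, Filter.eventually_map]
  have := continuous_subtype_val.continuousAt (x := (⟨v, hv⟩ : {v : Fin (d + 1) → ℂ // v ≠ 0}))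
  filter_upwards [this.eventually h] with x hx
  rwa [homPt_of_ne_zero x.2] at hx

theorem eventually_rep_apply_ne_zero {d : ℕ} (k : Fin (d + 1)) {p : ℙ ℂ (Fin (d + 1) → ℂ)}
    (hp : p.rep k ≠ 0) : ∀ᶠ q in 𝓝 p, q.rep k ≠ 0 := by
  rw [← homPt_rep p]
  refine eventually_homPt p.rep_nonzero ?_
  have h1 : ∀ᶠ x in 𝓝 p.rep, x k ≠ 0 := (continuous_apply k).continuousAt.eventually_ne hp
  filter_upwards [h1, isOpen_ne.mem_nhds p.rep_nonzero] with x h1 h2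
  rwa [Ne, rep_homPt_apply_eq_zero k h2]

theorem continuousAt_affineCoords {d : ℕ} (k : Fin (d + 1)) {p : ℙ ℂ (Fin (d + 1) → ℂ)}
    (hp : p.rep k ≠ 0) : ContinuousAt (affineCoords k) p := by
  rw [← homPt_rep p, continuousAt_comp_homPt p.rep_nonzero]
  have : ContinuousAt (fun v : Fin (d + 1) → ℂ => (v k)⁻¹ • v) p.rep :=
    ((continuous_apply k).continuousAt.inv₀ hp).smul continuousAt_id
  refine this.congr ?_
  filter_upwards [isOpen_ne.mem_nhds p.rep_nonzero] with x hx
  rw [affineCoords_homPt k hx]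

theorem homPt_affineCoords {d : ℕ} (k : Fin (d + 1)) {p : ℙ ℂ (Fin (d + 1) → ℂ)}
    (hp : p.rep k ≠ 0) : homPt (affineCoords k p) = p := by
  rw [affineCoords, homPt_smul (inv_ne_zero hp), homPt_rep]

theorem HolomorphicNear.differentiableAt_affineCoords {d : ℕ} {f : ℂ → ℙ ℂ (Fin (d + 1) → ℂ)}
    {z : ℂ} (hf : HolomorphicNear f z) {k : Fin (d + 1)} (hk : (f z).rep k ≠ 0) :
    DifferentiableAt ℂ (fun z => affineCoords k (f z)) z := by
  obtain ⟨F, hF, h0, h⟩ := holomorphicNear_iff.1 hf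
  have hFk : F z k ≠ 0 := by
    rwa [Ne, ← rep_homPt_apply_eq_zero k h0, ← h.self_of_nhds]
  have hFd : DifferentiableAt ℂ F z := hF.differentiableAt
  have : DifferentiableAt ℂ (fun y => (F y k)⁻¹ • F y) z :=
    ((differentiableAt_pi.1 hFd k).inv hFk).smul hFd
  refine this.congr_of_eventuallyEq ?_
  filter_upwards [h, hF.continuousAt.eventually_ne h0] with y h1 h2
  rw [h1, affineCoords_homPt k h2]

/-- A continuous map to projective space that is holomorphic off the unit circle is holomorphic. -/
theorem holomorphicNear_of_continuous_of_off_circle {d : ℕ} {f : ℂ → ℙ ℂ (Fin (d + 1) → ℂ)}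
    {z₀ : ℂ} (hc : ∀ᶠ z in 𝓝 z₀, ContinuousAt f z)
    (hd : ∀ z, ‖z‖ ≠ 1 → HolomorphicNear f z) : HolomorphicNear f z₀ := by
  -- Work in an affine chart around `f z₀`, where the vector-valued removability statement applies.
  obtain ⟨k, hk⟩ := Function.ne_iff.1 (f z₀).rep_nonzero
  have hev : ∀ᶠ z in 𝓝 z₀, (f z).rep k ≠ 0 :=
    hc.self_of_nhds.eventually (eventually_rep_apply_ne_zero k hk)
  have hd' : ∀ᶠ z in 𝓝 z₀, DifferentiableAt ℂ (fun z => affineCoords k (f z)) z := by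
    filter_upwards [(hc.and hev).eventually_nhds] with z h
    by_cases hn : ‖z‖ = 1
    · refine differentiableAt_of_continuous_of_off_circle hn ?_
      filter_upwards [h] with y hy
      exact ⟨(continuousAt_affineCoords k hy.2).comp hy.1,
        fun hn => (hd y hn).differentiableAt_affineCoords hy.2⟩
    · exact (hd z hn).differentiableAt_affineCoords h.self_of_nhds.2
  refine holomorphicNear_iff.2 ⟨fun z => affineCoords k (f z),
    Complex.analyticAt_iff_eventually_differentiableAt.2 hd',
    smul_ne_zero (inv_ne_zero hk) (f z₀).rep_nonzero, ?_⟩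
  filter_upwards [hev] with z hz
  rw [homPt_affineCoords k hz]

/-! ## The involution in homogeneous coordinates -/

/-- The map of projective space given in homogeneous coordinates by the complex conjugate of `Φ`. -/
def conjMap {d : ℕ} (Φ : (Fin (d + 1) → ℂ) → Fin (d + 1) → ℂ) (p : ℙ ℂ (Fin (d + 1) → ℂ)) :
    ℙ ℂ (Fin (d + 1) → ℂ) :=
  homPt (star (Φ p.rep))

/-- The homogeneous holomorphic map `Φ` describes, after complex conjugation, the involution of the
orbit of `C` in homogeneous coordinates. -/
structure IsTauLift {d : ℕ} (C : Fin d → ℙ ℂ (Fin 2 → ℂ))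
    (Φ : (Fin (d + 1) → ℂ) → Fin (d + 1) → ℂ) (m : ℕ) : Prop where
  differentiable : Differentiable ℂ Φ
  map_smul : ∀ (c : ℂ) (v : Fin (d + 1) → ℂ), Φ (c • v) = c ^ m • Φ v
  ne_zero : ∀ A, Φ (orbitPoint C A).rep ≠ 0
  conjMap_orbitPoint : ∀ A, conjMap Φ (orbitPoint C A) = orbitPoint C (ddag A)

/-! ### Consequences of a lift: values of the involution, extension along curves, doubling of discs
-/

namespace IsTauLift

variable {d : ℕ} {C : Fin d → ℙ ℂ (Fin 2 → ℂ)} {Φ : (Fin (d + 1) → ℂ) → Fin (d + 1) → ℂ} {m : ℕ}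

theorem rep_homPt_eq_zero (h : IsTauLift C Φ m) {v : Fin (d + 1) → ℂ} (hv : v ≠ 0) :
    Φ (homPt v).rep = 0 ↔ Φ v = 0 := by
  obtain ⟨a, ha, h'⟩ := exists_rep_homPt hv
  rw [h', h.map_smul, smul_eq_zero_iff_right (pow_ne_zero _ ha)]

theorem conjMap_homPt (h : IsTauLift C Φ m) {v : Fin (d + 1) → ℂ} (hv : v ≠ 0) :
    conjMap Φ (homPt v) = homPt (star (Φ v)) := by
  obtain ⟨a, ha, h'⟩ := exists_rep_homPt hv
  rw [conjMap, h', h.map_smul, star_smul, homPt_smul]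
  exact star_ne_zero.2 (pow_ne_zero _ ha)

theorem continuousAt_conjMap (h : IsTauLift C Φ m) {p : ℙ ℂ (Fin (d + 1) → ℂ)}
    (hp : Φ p.rep ≠ 0) : ContinuousAt (conjMap Φ) p := by
  rw [← homPt_rep p, continuousAt_comp_homPt p.rep_nonzero]
  have : ContinuousAt (fun v => homPt (star (Φ v))) p.rep :=
    ContinuousAt.comp (f := fun v => star (Φ v)) (continuousAt_homPt (star_ne_zero.2 hp))
      (continuous_star.comp h.differentiable.continuous).continuousAt
  refine this.congr ?_
  filter_upwards [isOpen_ne.mem_nhds p.rep_nonzero] with x hx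
  rw [h.conjMap_homPt hx]

theorem eventually_ne_zero (h : IsTauLift C Φ m) {p : ℙ ℂ (Fin (d + 1) → ℂ)}
    (hp : Φ p.rep ≠ 0) : ∀ᶠ q in 𝓝 p, Φ q.rep ≠ 0 := by
  rw [← homPt_rep p]
  refine eventually_homPt p.rep_nonzero ?_
  filter_upwards [h.differentiable.continuous.continuousAt.eventually_ne hp,
    isOpen_ne.mem_nhds p.rep_nonzero] with x h1 h2
  rwa [Ne, h.rep_homPt_eq_zero h2]

theorem ne_zero_of_mem (h : IsTauLift C Φ m) {p : ℙ ℂ (Fin (d + 1) → ℂ)} (hp : p ∈ openOrbit C) :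
    Φ p.rep ≠ 0 := by
  obtain ⟨A, rfl⟩ := hp
  exact h.ne_zero A

/-- The right-hand side does not mention a group element, so the choice made in `tau` is immaterial.
-/
theorem tau_eq (h : IsTauLift C Φ m) {p : ℙ ℂ (Fin (d + 1) → ℂ)} (hp : p ∈ openOrbit C) :
    tau C p = conjMap Φ p := by
  have hp' : ∃ A, orbitPoint C A = p := hp
  rw [tau, dif_pos hp', ← h.conjMap_orbitPoint, hp'.choose_spec]

theorem tau_orbitPoint (h : IsTauLift C Φ m) (A : Matrix.SpecialLinearGroup (Fin 2) ℂ) :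
    tau C (orbitPoint C A) = orbitPoint C (ddag A) := by
  rw [h.tau_eq ⟨A, rfl⟩, h.conjMap_orbitPoint]

theorem conjMap_mem_openOrbit (h : IsTauLift C Φ m) {p : ℙ ℂ (Fin (d + 1) → ℂ)}
    (hp : p ∈ openOrbit C) : conjMap Φ p ∈ openOrbit C := by
  obtain ⟨A, rfl⟩ := hp
  rw [h.conjMap_orbitPoint]
  exact ⟨_, rfl⟩

/-- Continuity at `p` carries the invariance of the orbit to its closure. This is needed because a
disc may leave the orbit at points where `Φ` does not vanish. -/
theorem conjMap_mem_orbitClosure (h : IsTauLift C Φ m) {p : ℙ ℂ (Fin (d + 1) → ℂ)}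
    (hp : p ∈ orbitClosure C) (h0 : Φ p.rep ≠ 0) : conjMap Φ p ∈ orbitClosure C := by
  refine closure_mono ?_ (mem_closure_image (h.continuousAt_conjMap h0) hp)
  rintro _ ⟨q, hq, rfl⟩
  exact h.conjMap_mem_openOrbit hq

theorem mem_openOrbit_of_mem_lagrangian {p : ℙ ℂ (Fin (d + 1) → ℂ)} (hp : p ∈ lagrangian C) :
    p ∈ openOrbit C := by
  obtain ⟨A, -, rfl⟩ := hp
  exact ⟨A, rfl⟩

/-- A unitary matrix satisfies `A^‡ = A`. -/
theorem conjMap_eq_self (h : IsTauLift C Φ m) {p : ℙ ℂ (Fin (d + 1) → ℂ)}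
    (hp : p ∈ lagrangian C) : conjMap Φ p = p := by
  obtain ⟨A, hA, rfl⟩ := hp
  have : ddag A = A := by
    apply Subtype.ext
    have hU : star (A : Matrix (Fin 2) (Fin 2) ℂ) * A = 1 :=
      Matrix.mem_unitaryGroup_iff'.1 (Matrix.mem_specialUnitaryGroup_iff.1 hA).1
    have hinv : ((A⁻¹ : Matrix.SpecialLinearGroup (Fin 2) ℂ) : Matrix (Fin 2) (Fin 2) ℂ) =
        star (A : Matrix (Fin 2) (Fin 2) ℂ) := by
      have h1 : (A : Matrix (Fin 2) (Fin 2) ℂ) *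
          ((A⁻¹ : Matrix.SpecialLinearGroup (Fin 2) ℂ) : Matrix (Fin 2) (Fin 2) ℂ) = 1 := by
        rw [← Matrix.SpecialLinearGroup.coe_mul, mul_inv_cancel, Matrix.SpecialLinearGroup.coe_one]
      exact (left_inv_eq_right_inv hU h1).symm
    change ((A⁻¹ : Matrix.SpecialLinearGroup (Fin 2) ℂ) : Matrix (Fin 2) (Fin 2) ℂ).conjTranspose
      = A
    rw [hinv, Matrix.star_eq_conjTranspose, Matrix.conjTranspose_conjTranspose]
  rw [h.conjMap_orbitPoint, this]

/-- Along a holomorphic curve, the common zeros of `Φ` can be divided out. -/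
theorem exists_extension (h : IsTauLift C Φ m) {u : ℂ → ℙ ℂ (Fin (d + 1) → ℂ)} {z : ℂ}
    (hu : HolomorphicNear u z) (h0 : ¬∀ᶠ y in 𝓝 z, Φ (u y).rep = 0) :
    ∃ G : ℂ → Fin (d + 1) → ℂ, AnalyticAt ℂ G z ∧ G z ≠ 0 ∧
      ∀ᶠ y in 𝓝 z, (y ≠ z → Φ (u y).rep ≠ 0) ∧
        (Φ (u y).rep ≠ 0 → conjMap Φ (u y) = homPt (star (G y))) := by
  obtain ⟨F, hF, hF0, hF'⟩ := holomorphicNear_iff.1 hu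
  have hev : ∀ᶠ y in 𝓝 z, F y ≠ 0 ∧ u y = homPt (F y) :=
    (hF.continuousAt.eventually_ne hF0).and hF'
  have han : AnalyticAt ℂ (fun y => Φ (F y)) z := by
    rw [Complex.analyticAt_iff_eventually_differentiableAt] at hF ⊢
    filter_upwards [hF] with y hy
    exact (h.differentiable (F y)).comp y hy
  have hne : ¬∀ᶠ y in 𝓝 z, Φ (F y) = 0 := by
    refine fun hc => h0 ?_
    filter_upwards [hc, hev] with y h1 h2
    rwa [h2.2, h.rep_homPt_eq_zero h2.1]
  -- Factor out the order of vanishing at `z`. The scalar `(y - z) ^ n` is invisible in projective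
  -- space for `y ≠ z`.
  obtain ⟨n, G, hG, hG0, hFG⟩ := han.exists_eventuallyEq_pow_smul_nonzero_iff.2 hne
  refine ⟨G, hG, hG0, ?_⟩
  filter_upwards [hev, hFG, hG.continuousAt.eventually_ne hG0] with y h1 h2 h3
  simp only [h1.2, Ne, h.rep_homPt_eq_zero h1.1, h.conjMap_homPt h1.1, h2]
  refine ⟨fun hy => smul_ne_zero (pow_ne_zero _ (sub_ne_zero.2 hy)) h3, fun hy => ?_⟩
  rw [star_smul, homPt_smul (star_ne_zero.2 fun h' => hy (by rw [h', zero_smul]))]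

/-- The extension over a puncture of the involution applied to a holomorphic curve. -/
theorem exists_continuousOn_extension (h : IsTauLift C Φ m) {U : Set ℂ} (hU : IsOpen U)
    (hU0 : (0 : ℂ) ∈ U) {u : ℂ → ℙ ℂ (Fin (d + 1) → ℂ)} (hu : HolomorphicOnOpen u U)
    (huW : Set.MapsTo u (U \ {0}) (openOrbit C)) :
    ∃ v : ℂ → ℙ ℂ (Fin (d + 1) → ℂ), ContinuousOn v U ∧ Set.MapsTo v U (orbitClosure C) ∧
      Set.EqOn v (tau C ∘ u) (U \ {0}) := by
  classical
  have hUn : ∀ᶠ y in 𝓝[≠] (0 : ℂ), y ∈ U \ {0} := by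
    filter_upwards [mem_nhdsWithin_of_mem_nhds (hU.mem_nhds hU0), self_mem_nhdsWithin]
      with y h1 h2 using ⟨h1, h2⟩
  obtain ⟨G, hG, hG0, hev⟩ := h.exists_extension (hu 0 hU0) fun hc => by
    obtain ⟨y, h1, h2⟩ := (hUn.and (mem_nhdsWithin_of_mem_nhds hc)).exists
    exact h.ne_zero_of_mem (huW h1) h2
  set v : ℂ → ℙ ℂ (Fin (d + 1) → ℂ) := fun y =>
    if y = 0 then homPt (star (G 0)) else conjMap Φ (u y) with hv
  have hv0 : ∀ y, y ≠ 0 → v y = conjMap Φ (u y) := fun y hy => if_neg hy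
  have hvc : ∀ z ∈ U, ContinuousAt v z := by
    intro z hz
    by_cases hz0 : z = 0
    · subst hz0
      have : ContinuousAt (fun y => homPt (star (G y))) 0 :=
        ContinuousAt.comp (f := fun y => star (G y)) (continuousAt_homPt (star_ne_zero.2 hG0))
          hG.continuousAt.star
      refine this.congr ?_
      filter_upwards [hev] with y hy
      by_cases hy0 : y = 0
      · simp [hv, hy0]
      · rw [hv0 y hy0, hy.2 (hy.1 hy0)]
    · have : ContinuousAt (fun y => conjMap Φ (u y)) z :=
        (h.continuousAt_conjMap (h.ne_zero_of_mem (huW ⟨hz, hz0⟩))).comp (hu z hz).continuousAt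
      refine this.congr ?_
      filter_upwards [isOpen_ne.mem_nhds hz0] with y hy
      rw [hv0 y hy]
  have hvW : ∀ z ∈ U \ {0}, v z ∈ orbitClosure C := by
    intro z hz
    rw [hv0 z hz.2]
    exact subset_closure (h.conjMap_mem_openOrbit (huW hz))
  refine ⟨v, fun z hz => (hvc z hz).continuousWithinAt, fun z hz => ?_, fun z hz => ?_⟩
  · by_cases hz0 : z = 0
    · subst hz0
      exact isClosed_closure.mem_of_tendsto ((hvc 0 hz).tendsto.mono_left nhdsWithin_le_nhds)
        (hUn.mono hvW)
    · exact hvW z ⟨hz, hz0⟩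
  · rw [hv0 z hz.2, Function.comp_apply, h.tau_eq (huW hz)]

/-- The zeros of `Φ` on a holomorphic disc do not accumulate. -/
theorem not_eventually_eq_zero (h : IsTauLift C Φ m) {u : ℂ → ℙ ℂ (Fin (d + 1) → ℂ)}
    (hu : IsHolomorphicDisc C u) {z : ℂ} (hz : z ∈ Metric.ball (0 : ℂ) 1) :
    ¬∀ᶠ y in 𝓝 z, Φ (u y).rep = 0 := by
  intro hc
  -- Identity principle: the set where `Φ ∘ u` vanishes locally is open, and relatively closed
  -- because any other zero is isolated. If nonempty it fills the disc, contradicting nonvanishing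
  -- near the boundary point `1`.
  have hsub : Metric.ball (0 : ℂ) 1 ⊆ {x | ∀ᶠ y in 𝓝 x, Φ (u y).rep = 0} := by
    refine (convex_ball (0 : ℂ) 1).isPreconnected.subset_of_closure_inter_subset
      isOpen_setOfPred_eventually_nhds ⟨z, hz, hc⟩ ?_
    rintro x ⟨hx, hxb⟩
    by_contra hx0
    obtain ⟨G, -, -, hev⟩ := h.exists_extension (hu.holomorphic x hxb) hx0
    have hfr := mem_closure_iff_frequently.1 hx
    obtain ⟨y, h1, h2⟩ := (hfr.and_eventually hev).exists
    have h1 : ∀ᶠ t in 𝓝 y, Φ (u t).rep = 0 := h1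
    by_cases hyx : y = x
    · exact hx0 (hyx ▸ h1)
    · exact h2.1 hyx h1.self_of_nhds
  have hone : (1 : ℂ) ∈ closure (Metric.ball (0 : ℂ) 1) := by
    rw [closure_ball _ one_ne_zero]; simp
  have h1 : Φ (u 1).rep ≠ 0 :=
    h.ne_zero_of_mem (mem_openOrbit_of_mem_lagrangian (hu.boundary (by simp)))
  have hcont : Filter.Tendsto u (𝓝[Metric.ball 0 1] 1) (𝓝 (u 1)) :=
    (hu.continuousOn 1 (by simp)).mono_left (nhdsWithin_mono _ Metric.ball_subset_closedBall)
  have : (𝓝[Metric.ball (0 : ℂ) 1] 1).NeBot := mem_closure_iff_nhdsWithin_neBot.1 hone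
  obtain ⟨y, hy1, hy2⟩ := ((hcont.eventually (h.eventually_ne_zero h1)).and
    self_mem_nhdsWithin).exists
  exact hy1 (hsub hy2).self_of_nhds

/-- The involution applied to a holomorphic disc extends to an antiholomorphic disc. -/
theorem exists_antiholomorphic_extension (h : IsTauLift C Φ m)
    {u : ℂ → ℙ ℂ (Fin (d + 1) → ℂ)} (hu : IsHolomorphicDisc C u) :
    ∃ v : ℂ → ℙ ℂ (Fin (d + 1) → ℂ),
      (∀ z, Φ (u z).rep ≠ 0 → v z = conjMap Φ (u z)) ∧
      (∀ z ∈ Metric.ball (0 : ℂ) 1, HolomorphicNear (fun y => v (star y)) (star z)) ∧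
      ∀ z ∈ Metric.closedBall (0 : ℂ) 1, v z ∈ orbitClosure C := by
  classical
  have hex : ∀ z, ∃ G : ℂ → Fin (d + 1) → ℂ, z ∈ Metric.ball (0 : ℂ) 1 →
      AnalyticAt ℂ G z ∧ G z ≠ 0 ∧ ∀ᶠ y in 𝓝 z, (y ≠ z → Φ (u y).rep ≠ 0) ∧
        (Φ (u y).rep ≠ 0 → conjMap Φ (u y) = homPt (star (G y))) := by
    intro z
    by_cases hz : z ∈ Metric.ball (0 : ℂ) 1
    · obtain ⟨G, hG⟩ := h.exists_extension (hu.holomorphic z hz) (h.not_eventually_eq_zero hu hz)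
      exact ⟨G, fun _ => hG⟩
    · exact ⟨0, fun h => absurd h hz⟩
  choose G hG using hex
  -- At a zero of `Φ` in the disc, use the factor `G z` belonging to that same point; near `z` this
  -- agrees with `[conj (G z)]`.
  set v : ℂ → ℙ ℂ (Fin (d + 1) → ℂ) := fun z =>
    if Φ (u z).rep = 0 then homPt (star (G z z)) else conjMap Φ (u z) with hv
  have hv1 : ∀ z, Φ (u z).rep ≠ 0 → v z = conjMap Φ (u z) := fun z hz => if_neg hz
  have hev : ∀ z ∈ Metric.ball (0 : ℂ) 1, ∀ᶠ y in 𝓝 z, v y = homPt (star (G z y)) := by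
    intro z hz
    filter_upwards [(hG z hz).2.2] with y hy
    by_cases h0 : Φ (u y).rep = 0
    · obtain rfl : y = z := by_contra fun hne => hy.1 hne h0
      simp [hv, h0]
    · rw [hv1 y h0, hy.2 h0]
  refine ⟨v, hv1, fun z hz => ?_, fun z hz => ?_⟩
  · refine holomorphicNear_iff.2 ⟨fun y => star (G z (star y)), ?_, ?_, ?_⟩
    · have hd := Complex.analyticAt_iff_eventually_differentiableAt.1 (hG z hz).1
      rw [Complex.analyticAt_iff_eventually_differentiableAt]
      have ht : Filter.Tendsto (star : ℂ → ℂ) (𝓝 (star z)) (𝓝 z) := by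
        simpa using (continuous_star (R := ℂ)).tendsto (star z)
      filter_upwards [ht.eventually hd] with y hy
      have := hy.star_star
      rwa [star_star] at this
    · simpa using (hG z hz).2.1
    · have ht : Filter.Tendsto (star : ℂ → ℂ) (𝓝 (star z)) (𝓝 z) := by
        simpa using (continuous_star (R := ℂ)).tendsto (star z)
      exact ht.eventually (hev z hz)
  · by_cases h0 : Φ (u z).rep = 0
    · have hzb : z ∈ Metric.ball (0 : ℂ) 1 := by
        rcases (Metric.mem_closedBall.1 hz).lt_or_eq with hlt | heq
        · exact hlt
        · exact absurd h0 (h.ne_zero_of_mem (mem_openOrbit_of_mem_lagrangian (hu.boundary heq)))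
      have hc : ContinuousAt v z := by
        have : ContinuousAt (fun y => homPt (star (G z y))) z :=
          ContinuousAt.comp (f := fun y => star (G z y))
            (continuousAt_homPt (star_ne_zero.2 (hG z hzb).2.1)) (hG z hzb).1.continuousAt.star
        exact this.congr ((hev z hzb).mono fun y hy => hy.symm)
      refine isClosed_closure.mem_of_tendsto (hc.tendsto.mono_left
        (nhdsWithin_le_nhds (s := {z}ᶜ))) ?_
      filter_upwards [mem_nhdsWithin_of_mem_nhds (hG z hzb).2.2, self_mem_nhdsWithin,
        mem_nhdsWithin_of_mem_nhds (Metric.isOpen_ball.mem_nhds hzb)] with y h1 h2 h3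
      rw [hv1 y (h1.1 h2)]
      exact h.conjMap_mem_orbitClosure (hu.mapsTo (Metric.ball_subset_closedBall h3)) (h1.1 h2)
    · rw [hv1 z h0]
      exact h.conjMap_mem_orbitClosure (hu.mapsTo hz) h0

/-- The double of a holomorphic disc with boundary on the `SU(2)`-orbit. -/
theorem exists_double (h : IsTauLift C Φ m)
    {u : ℂ → ℙ ℂ (Fin (d + 1) → ℂ)} (hu : IsHolomorphicDisc C u) :
    ∃ w : OnePoint ℂ → ℙ ℂ (Fin (d + 1) → ℂ), HolomorphicSphere w ∧
      (∀ x, w x ∈ orbitClosure C) ∧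
      (∀ z ∈ Metric.closedBall (0 : ℂ) 1, w (z : OnePoint ℂ) = u z) ∧
      (∀ z ∈ Metric.closedBall (0 : ℂ) 1, u z ∈ openOrbit C →
        w (reflect z) = tau C (u z)) := by
  classical
  obtain ⟨v, hv, hvh, hvX⟩ := h.exists_antiholomorphic_extension hu
  have hL : ∀ z : ℂ, ‖z‖ = 1 → u z ∈ lagrangian C := fun z hz => hu.boundary (by simpa using hz)
  have hL0 : ∀ z : ℂ, ‖z‖ = 1 → Φ (u z).rep ≠ 0 := fun z hz =>
    h.ne_zero_of_mem (mem_openOrbit_of_mem_lagrangian (hL z hz))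
  have hvu : ∀ z : ℂ, ‖z‖ = 1 → v z = u z := fun z hz => by
    rw [hv z (hL0 z hz), h.conjMap_eq_self (hL z hz)]
  -- Schwarz reflection; the two formulas agree on the circle by `hvu`.
  set f : ℂ → ℙ ℂ (Fin (d + 1) → ℂ) := fun z =>
    if ‖z‖ ≤ 1 then u z else v (star z⁻¹) with hf
  have f_in : ∀ z : ℂ, ‖z‖ ≤ 1 → f z = u z := fun z hz => if_pos hz
  have f_out : ∀ z : ℂ, 1 ≤ ‖z‖ → f z = v (star z⁻¹) := by
    intro z hz
    rcases hz.eq_or_lt with heq | hlt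
    · have : star z⁻¹ = z := by
        rw [star_inv₀, Complex.inv_def]
        simp [Complex.normSq_eq_norm_sq, ← heq]
      rw [this, f_in z heq.symm.le, hvu z heq.symm]
    · exact if_neg (not_le.2 hlt)
  have fh_off : ∀ z : ℂ, ‖z‖ ≠ 1 → HolomorphicNear f z := by
    intro z hz
    rcases hz.lt_or_gt with hlt | hgt
    · refine (hu.holomorphic z (by simpa using hlt)).congr ?_
      filter_upwards [continuous_norm.continuousAt.eventually_lt continuousAt_const hlt] with y hy
      exact f_in y hy.le
    · have hz0 : z ≠ 0 := by rintro rfl; simp at hgt; linarith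
      have h1 := hvh (star z⁻¹) (by simpa using inv_lt_one_of_one_lt₀ hgt)
      rw [star_star] at h1
      refine (h1.comp (φ := fun y => y⁻¹) (analyticAt_inv hz0)).congr ?_
      filter_upwards [continuousAt_const.eventually_lt continuous_norm.continuousAt hgt] with y hy
      exact f_out y hy.le
  have fc_on : ∀ z : ℂ, ‖z‖ = 1 → ContinuousAt f z := by
    intro z hz
    have hz0 : z ≠ 0 := by rintro rfl; simp at hz
    have hin : ContinuousWithinAt f {y | ‖y‖ ≤ 1} z := by
      have : ContinuousWithinAt u {y | ‖y‖ ≤ 1} z := by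
        have := hu.continuousOn z (by simp [hz])
        convert this using 1
        ext y; simp
      exact this.congr (fun y hy => f_in y hy) (f_in z hz.le)
    have hout : ContinuousWithinAt f {y | 1 ≤ ‖y‖} z := by
      have hsz : star z⁻¹ ∈ Metric.closedBall (0 : ℂ) 1 := by simp [hz]
      have hn : ‖star z⁻¹‖ = 1 := by simp [hz]
      have hr : ContinuousWithinAt (fun y : ℂ => star y⁻¹) {y | 1 ≤ ‖y‖} z :=
        (continuousAt_inv₀ hz0).star.continuousWithinAt
      have hmap : Set.MapsTo (fun y : ℂ => star y⁻¹) {y | 1 ≤ ‖y‖} (Metric.closedBall (0 : ℂ) 1) := by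
        intro y hy
        simpa using inv_le_one_of_one_le₀ hy
      have huc : ContinuousWithinAt (fun y : ℂ => u (star y⁻¹)) {y | 1 ≤ ‖y‖} z :=
        ContinuousWithinAt.comp (f := fun y : ℂ => star y⁻¹) (hu.continuousOn _ hsz) hr hmap
      have hcomp : ContinuousWithinAt (fun y : ℂ => conjMap Φ (u (star y⁻¹))) {y | 1 ≤ ‖y‖} z :=
        ContinuousAt.comp_continuousWithinAt (f := fun y : ℂ => u (star y⁻¹))
          (h.continuousAt_conjMap (hL0 _ hn)) huc
      refine hcomp.congr_of_eventuallyEq ?_ ?_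
      · filter_upwards [huc.eventually (h.eventually_ne_zero (hL0 _ hn)), self_mem_nhdsWithin]
          with y h1 h2
        rw [f_out y h2, hv _ h1]
      · rw [f_out z hz.ge, hv _ (hL0 _ hn)]
    have := hin.union hout
    rwa [show {y : ℂ | ‖y‖ ≤ 1} ∪ {y | 1 ≤ ‖y‖} = Set.univ from
      Set.eq_univ_of_forall fun y => le_total ‖y‖ 1, continuousWithinAt_univ] at this
  have fh : ∀ z, HolomorphicNear f z := by
    intro z
    by_cases hz : ‖z‖ = 1
    · refine holomorphicNear_of_continuous_of_off_circle (Filter.Eventually.of_forall fun y => ?_)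
        fh_off
      by_cases hy : ‖y‖ = 1
      · exact fc_on y hy
      · exact (fh_off y hy).continuousAt
    · exact fh_off z hz
  set w : OnePoint ℂ → ℙ ℂ (Fin (d + 1) → ℂ) := fun x => Option.elim x (v 0) f with hw
  have w_coe : ∀ z : ℂ, w (z : OnePoint ℂ) = f z := fun z => rfl
  have w_inf : w OnePoint.infty = v 0 := rfl
  refine ⟨w, ⟨fun z _ => fh z, fun z _ => ?_⟩, fun x => ?_, fun z hz => ?_, fun z hz hW => ?_⟩
  · by_cases hz : z = 0
    · subst hz
      have h1 := hvh 0 (by simp)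
      rw [star_zero] at h1
      refine h1.congr ?_
      filter_upwards [Metric.ball_mem_nhds (0 : ℂ) one_pos] with y hy
      by_cases hy0 : y = 0
      · simp [hy0, w_inf]
      · rw [if_neg hy0, w_coe, f_out, inv_inv]
        rw [norm_inv]
        exact (one_le_inv₀ (norm_pos_iff.2 hy0)).2 (by simpa using (Metric.mem_ball.1 hy).le)
    · refine ((fh z⁻¹).comp (φ := fun y => y⁻¹) (analyticAt_inv hz)).congr ?_
      filter_upwards [isOpen_ne.mem_nhds hz] with y hy
      rw [if_neg hy, w_coe]
  · induction x using OnePoint.rec with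
    | infty => exact hvX 0 (by simp)
    | coe z =>
      rw [w_coe]
      rcases le_total ‖z‖ 1 with hz | hz
      · rw [f_in z hz]
        exact hu.mapsTo (by simpa using hz)
      · rw [f_out z hz]
        exact hvX _ (by simpa using inv_le_one_of_one_le₀ hz)
  · rw [w_coe, f_in z (by simpa using hz)]
  · rw [h.tau_eq hW, ← hv z (h.ne_zero_of_mem hW)]
    by_cases hz0 : z = 0
    · simp [reflect, hz0, w_inf]
    · rw [reflect, if_neg hz0, w_coe, f_out]
      · simp
      · rw [norm_inv, RCLike.norm_conj]
        exact (one_le_inv₀ (norm_pos_iff.2 hz0)).2 (by simpa using hz)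

end IsTauLift

/-! ## Products of linear forms -/

theorem formPoly_smul {d : ℕ} (c : Fin d → ℂ) (v : Fin d → Fin 2 → ℂ) :
    formPoly (fun i => c i • v i) = Polynomial.C (∏ i, c i) * formPoly v := by
  unfold formPoly
  rw [map_prod, ← Finset.prod_mul_distrib]
  refine Finset.prod_congr rfl fun i _ => ?_
  simp [mul_add, mul_assoc]

theorem formCoords_smul {d : ℕ} (c : Fin d → ℂ) (v : Fin d → Fin 2 → ℂ) :
    formCoords (fun i => c i • v i) = (∏ i, c i) • formCoords v := by
  funext j
  simp only [formCoords, formPoly_smul, Polynomial.coeff_C_mul, Pi.smul_apply, smul_eq_mul]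

theorem formCoords_comp_perm {d : ℕ} (σ : Equiv.Perm (Fin d)) (v : Fin d → Fin 2 → ℂ) :
    formCoords (fun i => v (σ i)) = formCoords v := by
  funext j
  have : formPoly (fun i => v (σ i)) = formPoly v :=
    Equiv.prod_comp σ fun i => (Polynomial.C (v i 0) + Polynomial.C (v i 1) * Polynomial.X)
  simp [formCoords, this]

/-- The quaternionic structure of `ℂ²`, which covers the antipodal map of the sphere. -/
def quatJ (v : Fin 2 → ℂ) : Fin 2 → ℂ := ![-star (v 1), star (v 0)]

theorem quatJ_ne_zero {v : Fin 2 → ℂ} (hv : v ≠ 0) : quatJ v ≠ 0 := by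
  intro h
  have h0 := congrFun h 0
  have h1 := congrFun h 1
  simp [quatJ] at h0 h1
  exact hv (by funext i; fin_cases i <;> simp [h0, h1])

/-- Reversing coefficients is multiplicative and swaps the two coefficients of each linear factor.
The reversal degree must be the number of factors, not the actual degree, since factors may be
constant. -/
theorem reflect_formPoly {d : ℕ} (v : Fin d → Fin 2 → ℂ) :
    (formPoly v).reflect d = formPoly fun i => ![v i 1, v i 0] := by
  have key : ∀ s : Finset (Fin d),
      (∏ i ∈ s, (Polynomial.C (v i 0) + Polynomial.C (v i 1) * Polynomial.X)).natDegree ≤ s.card ∧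
      (∏ i ∈ s, (Polynomial.C (v i 0) + Polynomial.C (v i 1) * Polynomial.X)).reflect s.card =
        ∏ i ∈ s, (Polynomial.C (v i 1) + Polynomial.C (v i 0) * Polynomial.X) := by
    intro s
    induction s using Finset.induction_on with
    | empty => simp
    | insert a s ha ih =>
      have hdeg : (Polynomial.C (v a 0) + Polynomial.C (v a 1) * Polynomial.X).natDegree ≤ 1 := by
        rw [add_comm]
        exact Polynomial.natDegree_linear_le
      rw [Finset.prod_insert ha, Finset.prod_insert ha, Finset.card_insert_of_notMem ha,
        add_comm s.card]
      refine ⟨Polynomial.natDegree_mul_le.trans (add_le_add hdeg ih.1), ?_⟩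
      rw [Polynomial.reflect_mul _ _ hdeg ih.1, ih.2]
      congr 1
      rw [Polynomial.reflect_add, Polynomial.reflect_C_mul, Polynomial.reflect_C, pow_one,
        ← pow_one (Polynomial.X : Polynomial ℂ), Polynomial.reflect_monomial,
        Polynomial.revAt_le le_rfl]
      simp [add_comm]
  simpa [formPoly] using (key Finset.univ).2

theorem formPoly_neg_X {d : ℕ} (v : Fin d → Fin 2 → ℂ) (k : ℕ) :
    (formPoly fun i => ![v i 0, -v i 1]).coeff k = (-1) ^ k * (formPoly v).coeff k := by
  have : (formPoly fun i => ![v i 0, -v i 1]) =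
      (formPoly v).comp (Polynomial.C (-1) * Polynomial.X) := by
    simp [formPoly, Polynomial.prod_comp]
  rw [this, Polynomial.comp_C_mul_X_coeff, mul_comm]

theorem formPoly_star {d : ℕ} (v : Fin d → Fin 2 → ℂ) :
    (formPoly fun i => star (v i)) = (formPoly v).map (starRingEnd ℂ) := by
  simp [formPoly, Polynomial.map_prod]

/-- The action of the quaternionic structure in standard coordinates of `S^d V`, up to
conjugation. -/
def quatCoords {d : ℕ} (z : Fin (d + 1) → ℂ) : Fin (d + 1) → ℂ :=
  fun k => (-1) ^ (d - (k : ℕ)) * z k.rev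

/-- On each linear factor `J` is the substitution `X ↦ -X`, followed by reversal and complex
conjugation. The substitution produces the sign in `quatCoords`. -/
theorem formCoords_quatJ {d : ℕ} (v : Fin d → Fin 2 → ℂ) :
    formCoords (fun i => quatJ (v i)) = star (quatCoords (formCoords v)) := by
  funext k
  have h1 : (fun i => quatJ (v i)) =
      fun i => star (![(![v i 0, -v i 1] : Fin 2 → ℂ) 1, (![v i 0, -v i 1] : Fin 2 → ℂ) 0]) := by
    funext i j
    fin_cases j <;> simp [quatJ]
  have hk : d + 1 - ((k : ℕ) + 1) = d - k := by omega
  simp only [formCoords, h1]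
  rw [formPoly_star (fun i => ![(![v i 0, -v i 1] : Fin 2 → ℂ) 1, (![v i 0, -v i 1] : Fin 2 → ℂ) 0]),
    Polynomial.coeff_map, ← reflect_formPoly, Polynomial.coeff_reflect,
    Polynomial.revAt_le (Nat.le_of_lt_succ k.2), formPoly_neg_X]
  simp [quatCoords, formCoords, Fin.val_rev, hk]

theorem quatCoords_smul {d : ℕ} (c : ℂ) (z : Fin (d + 1) → ℂ) :
    quatCoords (c • z) = c • quatCoords z := by
  funext k
  simp [quatCoords]
  ring

theorem quatCoords_ne_zero {d : ℕ} {z : Fin (d + 1) → ℂ} (hz : z ≠ 0) : quatCoords z ≠ 0 := by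
  obtain ⟨k, hk⟩ := Function.ne_iff.1 hz
  refine Function.ne_iff.2 ⟨k.rev, ?_⟩
  simpa [quatCoords] using hk

theorem differentiable_quatCoords {d : ℕ} :
    Differentiable ℂ (quatCoords : (Fin (d + 1) → ℂ) → Fin (d + 1) → ℂ) := by
  rw [differentiable_pi]
  intro k
  unfold quatCoords
  fun_prop

theorem mulVec_ne_zero (A : Matrix.SpecialLinearGroup (Fin 2) ℂ) {v : Fin 2 → ℂ} (hv : v ≠ 0) :
    (A : Matrix (Fin 2) (Fin 2) ℂ).mulVec v ≠ 0 := by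
  intro h
  apply hv
  have := congrArg ((A⁻¹ : Matrix.SpecialLinearGroup (Fin 2) ℂ) : Matrix (Fin 2) (Fin 2) ℂ).mulVec h
  rwa [Matrix.mulVec_mulVec, ← Matrix.SpecialLinearGroup.coe_mul, inv_mul_cancel,
    Matrix.SpecialLinearGroup.coe_one, Matrix.one_mulVec, Matrix.mulVec_zero] at this

/-- For determinant one, `A^‡` is the conjugate of `A` by `J`; the sign comes from `J² = -1`. -/
theorem ddag_mulVec (A : Matrix.SpecialLinearGroup (Fin 2) ℂ) (v : Fin 2 → ℂ) :
    (ddag A : Matrix (Fin 2) (Fin 2) ℂ).mulVec v =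
      (-1 : ℂ) • quatJ ((A : Matrix (Fin 2) (Fin 2) ℂ).mulVec (quatJ v)) := by
  have h : (ddag A : Matrix (Fin 2) (Fin 2) ℂ) =
      ((A⁻¹ : Matrix.SpecialLinearGroup (Fin 2) ℂ) : Matrix (Fin 2) (Fin 2) ℂ).conjTranspose := rfl
  rw [h, Matrix.SpecialLinearGroup.coe_inv, Matrix.adjugate_fin_two]
  funext i
  fin_cases i <;> simp [quatJ, Matrix.mulVec, dotProduct, Fin.sum_univ_two]
  ring

theorem orbitPoint_mk {d : ℕ} (v : Fin d → Fin 2 → ℂ) (hv : ∀ i, v i ≠ 0)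
    (A : Matrix.SpecialLinearGroup (Fin 2) ℂ) :
    orbitPoint (fun i => Projectivization.mk ℂ (v i) (hv i)) A =
      homPt (formCoords fun i => (A : Matrix (Fin 2) (Fin 2) ℂ).mulVec (v i)) := by
  have hv' := fun i => mulVec_ne_zero A (hv i)
  rw [homPt_of_ne_zero (formCoords_ne_zero _ hv'), ← symPoint_mk _ hv']
  rfl

/-- A covariant that takes the orbit of `C` to that of the antipodal configuration describes the
involution. -/
theorem isTauLift_of_antipodal {d : ℕ} (v : Fin d → Fin 2 → ℂ) (hv : ∀ i, v i ≠ 0)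
    {Ψ : (Fin (d + 1) → ℂ) → Fin (d + 1) → ℂ} {m : ℕ} (hd : Differentiable ℂ Ψ)
    (hs : ∀ (c : ℂ) (z : Fin (d + 1) → ℂ), Ψ (c • z) = c ^ m • Ψ z)
    (h : ∀ A : Matrix.SpecialLinearGroup (Fin 2) ℂ, ∃ κ : ℂ, κ ≠ 0 ∧
      Ψ (formCoords fun i => (A : Matrix (Fin 2) (Fin 2) ℂ).mulVec (v i)) =
        κ • formCoords fun i => (A : Matrix (Fin 2) (Fin 2) ℂ).mulVec (quatJ (v i))) :
    IsTauLift (fun i => Projectivization.mk ℂ (v i) (hv i)) (fun z => quatCoords (Ψ z)) m := by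
  have hs' : ∀ (c : ℂ) (z : Fin (d + 1) → ℂ),
      quatCoords (Ψ (c • z)) = c ^ m • quatCoords (Ψ z) := fun c z => by
    rw [hs, quatCoords_smul]
  have key : ∀ A : Matrix.SpecialLinearGroup (Fin 2) ℂ, ∃ κ : ℂ, κ ≠ 0 ∧
      quatCoords (Ψ (orbitPoint (fun i => Projectivization.mk ℂ (v i) (hv i)) A).rep) =
        κ • quatCoords (formCoords fun i =>
          (A : Matrix (Fin 2) (Fin 2) ℂ).mulVec (quatJ (v i))) := by
    intro A
    obtain ⟨κ, hκ, e⟩ := h A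
    obtain ⟨a, ha, h'⟩ := exists_rep_homPt
      (formCoords_ne_zero _ fun i => mulVec_ne_zero A (hv i))
    refine ⟨a ^ m * κ, mul_ne_zero (pow_ne_zero _ ha) hκ, ?_⟩
    rw [orbitPoint_mk, h', hs', e, quatCoords_smul, smul_smul]
  refine ⟨differentiable_quatCoords.comp hd, hs', fun A => ?_, fun A => ?_⟩
  · obtain ⟨κ, hκ, e⟩ := key A
    rw [e]
    exact smul_ne_zero hκ (quatCoords_ne_zero
      (formCoords_ne_zero _ fun i => mulVec_ne_zero A (quatJ_ne_zero (hv i))))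
  · obtain ⟨κ, hκ, e⟩ := key A
    -- Both sides are the class of the product of the vectors `J (A (J vᵢ))`, up to nonzero scalars.
    rw [conjMap, e, star_smul, homPt_smul (star_ne_zero.2 hκ), orbitPoint_mk]
    simp only [ddag_mulVec]
    rw [formCoords_smul, homPt_smul (by simp), formCoords_quatJ]

/-- If `C` is its own antipode, the involution is induced by the antipodal map. -/
theorem exists_isTauLift_of_centrallySymmetric {d : ℕ} (v : Fin d → Fin 2 → ℂ)
    (hv : ∀ i, v i ≠ 0) {σ : Fin d → Fin d} (hσ : Function.Involutive σ)
    (h : ∀ i, ∃ c : ℂ, c ≠ 0 ∧ v (σ i) = c • quatJ (v i)) :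
    ∃ Φ m, IsTauLift (fun i => Projectivization.mk ℂ (v i) (hv i)) Φ m := by
  refine ⟨_, 1, isTauLift_of_antipodal v hv (Ψ := id) differentiable_id (by simp) fun A => ?_⟩
  choose c hc e using h
  refine ⟨∏ i, c i, Finset.prod_ne_zero_iff.2 fun i _ => hc i, ?_⟩
  rw [← formCoords_smul, ← formCoords_comp_perm hσ.toPerm]
  simp [e, Matrix.mulVec_smul]

/-! ## Covariants of binary cubics and quartics -/

/-- The cubic covariant (of degree three in the coefficients) of a binary cubic. -/
def cubicCovariant (z : Fin 4 → ℂ) : Fin 4 → ℂ :=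
  ![3 * z 0 * (9 * z 0 * z 3 - z 1 * z 2) - 2 * z 1 * (3 * z 0 * z 2 - z 1 ^ 2),
    6 * z 0 * (3 * z 1 * z 3 - z 2 ^ 2) + z 1 * (9 * z 0 * z 3 - z 1 * z 2) -
      4 * z 2 * (3 * z 0 * z 2 - z 1 ^ 2),
    4 * z 1 * (3 * z 1 * z 3 - z 2 ^ 2) - z 2 * (9 * z 0 * z 3 - z 1 * z 2) -
      6 * z 3 * (3 * z 0 * z 2 - z 1 ^ 2),
    2 * z 2 * (3 * z 1 * z 3 - z 2 ^ 2) - 3 * z 3 * (9 * z 0 * z 3 - z 1 * z 2)]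

/-- The Hessian of a binary quartic. -/
def quarticHessian (z : Fin 5 → ℂ) : Fin 5 → ℂ :=
  ![24 * z 0 * z 2 - 9 * z 1 ^ 2, 72 * z 0 * z 3 - 12 * z 1 * z 2,
    144 * z 0 * z 4 + 18 * z 1 * z 3 - 12 * z 2 ^ 2, 72 * z 1 * z 4 - 12 * z 2 * z 3,
    24 * z 2 * z 4 - 9 * z 3 ^ 2]

theorem differentiable_cubicCovariant : Differentiable ℂ cubicCovariant := by
  rw [differentiable_pi]
  intro k
  fin_cases k <;> (simp [cubicCovariant]; fun_prop)

theorem differentiable_quarticHessian : Differentiable ℂ quarticHessian := by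
  rw [differentiable_pi]
  intro k
  fin_cases k <;> (simp [quarticHessian]; fun_prop)

theorem cubicCovariant_smul (c : ℂ) (z : Fin 4 → ℂ) :
    cubicCovariant (c • z) = c ^ 3 • cubicCovariant z := by
  funext k
  fin_cases k <;> (simp [cubicCovariant]; ring)

theorem quarticHessian_smul (c : ℂ) (z : Fin 5 → ℂ) :
    quarticHessian (c • z) = c ^ 2 • quarticHessian z := by
  funext k
  fin_cases k <;> (simp [quarticHessian]; ring)

theorem formCoords_three (v : Fin 3 → Fin 2 → ℂ) :
    formCoords v = ![v 0 0 * v 1 0 * v 2 0,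
      v 0 1 * v 1 0 * v 2 0 + v 0 0 * v 1 1 * v 2 0 + v 0 0 * v 1 0 * v 2 1,
      v 0 0 * v 1 1 * v 2 1 + v 0 1 * v 1 0 * v 2 1 + v 0 1 * v 1 1 * v 2 0,
      v 0 1 * v 1 1 * v 2 1] := by
  have h : formPoly v = ∑ k : Fin 4, Polynomial.monomial (k : ℕ)
      ((![v 0 0 * v 1 0 * v 2 0,
      v 0 1 * v 1 0 * v 2 0 + v 0 0 * v 1 1 * v 2 0 + v 0 0 * v 1 0 * v 2 1,
      v 0 0 * v 1 1 * v 2 1 + v 0 1 * v 1 0 * v 2 1 + v 0 1 * v 1 1 * v 2 0,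
      v 0 1 * v 1 1 * v 2 1] : Fin 4 → ℂ) k) := by
    simp only [formPoly, Fin.prod_univ_three, Fin.sum_univ_four, ← Polynomial.C_mul_X_pow_eq_monomial]
    simp
    ring
  funext k
  rw [formCoords, h, Polynomial.finsetSum_coeff]
  simp [Polynomial.coeff_monomial, Fin.val_inj]

theorem formCoords_four (v : Fin 4 → Fin 2 → ℂ) :
    formCoords v = ![v 0 0 * v 1 0 * v 2 0 * v 3 0,
      v 0 1 * v 1 0 * v 2 0 * v 3 0 + v 0 0 * v 1 1 * v 2 0 * v 3 0 +
        v 0 0 * v 1 0 * v 2 1 * v 3 0 + v 0 0 * v 1 0 * v 2 0 * v 3 1,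
      v 0 1 * v 1 1 * v 2 0 * v 3 0 + v 0 1 * v 1 0 * v 2 1 * v 3 0 +
        v 0 1 * v 1 0 * v 2 0 * v 3 1 + v 0 0 * v 1 1 * v 2 1 * v 3 0 +
        v 0 0 * v 1 1 * v 2 0 * v 3 1 + v 0 0 * v 1 0 * v 2 1 * v 3 1,
      v 0 0 * v 1 1 * v 2 1 * v 3 1 + v 0 1 * v 1 0 * v 2 1 * v 3 1 +
        v 0 1 * v 1 1 * v 2 0 * v 3 1 + v 0 1 * v 1 1 * v 2 1 * v 3 0,
      v 0 1 * v 1 1 * v 2 1 * v 3 1] := by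
  have h : formPoly v = ∑ k : Fin 5, Polynomial.monomial (k : ℕ)
      ((![v 0 0 * v 1 0 * v 2 0 * v 3 0,
      v 0 1 * v 1 0 * v 2 0 * v 3 0 + v 0 0 * v 1 1 * v 2 0 * v 3 0 +
        v 0 0 * v 1 0 * v 2 1 * v 3 0 + v 0 0 * v 1 0 * v 2 0 * v 3 1,
      v 0 1 * v 1 1 * v 2 0 * v 3 0 + v 0 1 * v 1 0 * v 2 1 * v 3 0 +
        v 0 1 * v 1 0 * v 2 0 * v 3 1 + v 0 0 * v 1 1 * v 2 1 * v 3 0 +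
        v 0 0 * v 1 1 * v 2 0 * v 3 1 + v 0 0 * v 1 0 * v 2 1 * v 3 1,
      v 0 0 * v 1 1 * v 2 1 * v 3 1 + v 0 1 * v 1 0 * v 2 1 * v 3 1 +
        v 0 1 * v 1 1 * v 2 0 * v 3 1 + v 0 1 * v 1 1 * v 2 1 * v 3 0,
      v 0 1 * v 1 1 * v 2 1 * v 3 1] : Fin 5 → ℂ) k) := by
    simp only [formPoly, Fin.prod_univ_four, Fin.sum_univ_five, ← Polynomial.C_mul_X_pow_eq_monomial]
    simp
    ring
  funext k
  rw [formCoords, h, Polynomial.finsetSum_coeff]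
  simp [Polynomial.coeff_monomial, Fin.val_inj]

/-- Coordinates of the quartic form `l * (l ^ 3 + e * m ^ 3)`. -/
def quarticNormalForm (l m : Fin 2 → ℂ) (e : ℂ) : Fin 5 → ℂ :=
  ![l 0 * (l 0 ^ 3 + e * m 0 ^ 3),
    l 1 * (l 0 ^ 3 + e * m 0 ^ 3) + 3 * l 0 * (l 0 ^ 2 * l 1 + e * m 0 ^ 2 * m 1),
    3 * l 1 * (l 0 ^ 2 * l 1 + e * m 0 ^ 2 * m 1) +
      3 * l 0 * (l 0 * l 1 ^ 2 + e * m 0 * m 1 ^ 2),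
    3 * l 1 * (l 0 * l 1 ^ 2 + e * m 0 * m 1 ^ 2) + l 0 * (l 1 ^ 3 + e * m 1 ^ 3),
    l 1 * (l 1 ^ 3 + e * m 1 ^ 3)]

/-- With the first two elementary symmetric functions zero, `(l + a m) (l + b m) (l + c m) = l³ +
abc m³`. -/
theorem formCoords_quartic (l m : Fin 2 → ℂ) {a b c : ℂ} (h1 : a + b + c = 0)
    (h2 : a * b + a * c + b * c = 0) :
    formCoords ![l, l + a • m, l + b • m, l + c • m] = quarticNormalForm l m (a * b * c) := by
  obtain rfl : c = -a - b := by linear_combination h1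
  rw [formCoords_four]
  funext k
  fin_cases k <;> simp [quarticNormalForm]
  · linear_combination (l 0 ^ 2 * m 0 ^ 2) * h2
  · linear_combination (2 * l 0 * l 1 * m 0 ^ 2 + 2 * l 0 ^ 2 * m 0 * m 1) * h2
  · linear_combination (l 1 ^ 2 * m 0 ^ 2 + 4 * l 0 * l 1 * m 0 * m 1 + l 0 ^ 2 * m 1 ^ 2) * h2
  · linear_combination (2 * l 1 ^ 2 * m 0 * m 1 + 2 * l 0 * l 1 * m 1 ^ 2) * h2
  · linear_combination (l 1 ^ 2 * m 1 ^ 2) * h2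

/-- The Hessian of `l (l³ + e m³)` is `-9 det² · m (e² m³ - 8 e l³)`, with `det` the determinant of
`l, m`. For a tetrahedron this is the antipodal one. -/
theorem quarticHessian_normalForm (l m : Fin 2 → ℂ) {e e' : ℂ} (he : e * e' = 8) :
    quarticHessian (quarticNormalForm l m e) =
      (-9 * e ^ 2 * (l 0 * m 1 - l 1 * m 0) ^ 2) • quarticNormalForm m l (-e') := by
  have he2 : e ^ 2 * e' = 8 * e := by linear_combination e * he
  funext k
  fin_cases k <;> simp [quarticNormalForm, quarticHessian]
  · linear_combination (-9 * (l 0 * m 1 - l 1 * m 0) ^ 2 * (m 0 * l 0 ^ 3)) * he2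
  · linear_combination (-9 * (l 0 * m 1 - l 1 * m 0) ^ 2 *
      (m 1 * l 0 ^ 3 + 3 * m 0 * l 0 ^ 2 * l 1)) * he2
  · linear_combination (-9 * (l 0 * m 1 - l 1 * m 0) ^ 2 *
      (3 * m 1 * l 0 ^ 2 * l 1 + 3 * m 0 * l 0 * l 1 ^ 2)) * he2
  · linear_combination (-9 * (l 0 * m 1 - l 1 * m 0) ^ 2 *
      (3 * m 1 * l 0 * l 1 ^ 2 + m 0 * l 1 ^ 3)) * he2
  · linear_combination (-9 * (l 0 * m 1 - l 1 * m 0) ^ 2 * (m 1 * l 1 ^ 3)) * he2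

/-- Coordinates of the cubic form `l * (l ^ 2 - c * m ^ 2)`. -/
def cubicNormalForm (l m : Fin 2 → ℂ) (c : ℂ) : Fin 4 → ℂ :=
  ![l 0 * (l 0 ^ 2 - c * m 0 ^ 2),
    l 1 * (l 0 ^ 2 - c * m 0 ^ 2) + 2 * l 0 * (l 0 * l 1 - c * m 0 * m 1),
    2 * l 1 * (l 0 * l 1 - c * m 0 * m 1) + l 0 * (l 1 ^ 2 - c * m 1 ^ 2),
    l 1 * (l 1 ^ 2 - c * m 1 ^ 2)]

theorem formCoords_cubic (l m : Fin 2 → ℂ) (a : ℂ) :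
    formCoords ![l, l + a • m, l + (-a) • m] = cubicNormalForm l m (a ^ 2) := by
  rw [formCoords_three]
  funext k
  fin_cases k <;> (simp [cubicNormalForm]; ring)

/-- The covariant, the Jacobian of a cubic and a multiple of its Hessian, sends `l (l² - c m²)` to
`2 det³ · m (c³ m² - 9 c² l²)`. -/
theorem cubicCovariant_normalForm (l m : Fin 2 → ℂ) {c c' : ℂ} (hc : c * c' = 9) :
    cubicCovariant (cubicNormalForm l m c) =
      (2 * c ^ 3 * (l 0 * m 1 - l 1 * m 0) ^ 3) • cubicNormalForm m l c' := by
  have hc2 : c ^ 3 * c' = 9 * c ^ 2 := by linear_combination c ^ 2 * hc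
  funext k
  fin_cases k <;> simp [cubicNormalForm, cubicCovariant]
  · linear_combination (2 * (l 0 * m 1 - l 1 * m 0) ^ 3 * (m 0 * l 0 ^ 2)) * hc2
  · linear_combination (2 * (l 0 * m 1 - l 1 * m 0) ^ 3 *
      (m 1 * l 0 ^ 2 + 2 * m 0 * l 0 * l 1)) * hc2
  · linear_combination (2 * (l 0 * m 1 - l 1 * m 0) ^ 3 *
      (2 * m 1 * l 0 * l 1 + m 0 * l 1 ^ 2)) * hc2
  · linear_combination (2 * (l 0 * m 1 - l 1 * m 0) ^ 3 * (m 1 * l 1 ^ 2)) * hc2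

/-! ### Triangles and tetrahedra in the frame `v, quatJ v` -/

theorem quatJ_smul (c : ℂ) (v : Fin 2 → ℂ) : quatJ (c • v) = star c • quatJ v := by
  funext i
  fin_cases i <;> simp [quatJ]

theorem quatJ_add_smul_quatJ (a : ℂ) (v : Fin 2 → ℂ) :
    quatJ (v + a • quatJ v) = quatJ v + (-star a) • v := by
  funext i
  fin_cases i <;> simp [quatJ, add_comm]

/-- As `det A = 1`, this determinant equals `|v 0|² + |v 1|²`. -/
theorem det_mulVec_quatJ_ne_zero (A : Matrix.SpecialLinearGroup (Fin 2) ℂ) {v : Fin 2 → ℂ}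
    (hv : v ≠ 0) :
    (A : Matrix (Fin 2) (Fin 2) ℂ).mulVec v 0 * (A : Matrix (Fin 2) (Fin 2) ℂ).mulVec (quatJ v) 1 -
      (A : Matrix (Fin 2) (Fin 2) ℂ).mulVec v 1 *
        (A : Matrix (Fin 2) (Fin 2) ℂ).mulVec (quatJ v) 0 ≠ 0 := by
  have hdet := A.2
  rw [Matrix.det_fin_two] at hdet
  have e : (A : Matrix (Fin 2) (Fin 2) ℂ).mulVec v 0 *
      (A : Matrix (Fin 2) (Fin 2) ℂ).mulVec (quatJ v) 1 -
      (A : Matrix (Fin 2) (Fin 2) ℂ).mulVec v 1 *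
        (A : Matrix (Fin 2) (Fin 2) ℂ).mulVec (quatJ v) 0 =
      ((Complex.normSq (v 0) + Complex.normSq (v 1) : ℝ) : ℂ) := by
    rw [Complex.ofReal_add, ← Complex.mul_conj, ← Complex.mul_conj]
    simp [quatJ, Matrix.mulVec, dotProduct, Fin.sum_univ_two]
    linear_combination (v 0 * (starRingEnd ℂ) (v 0) + v 1 * (starRingEnd ℂ) (v 1)) * hdet
  rw [e, Complex.ofReal_ne_zero]
  intro h
  apply hv
  have h0 := Complex.normSq_nonneg (v 0)
  have h1 := Complex.normSq_nonneg (v 1)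
  have h0' : v 0 = 0 := Complex.normSq_eq_zero.1 (by linarith)
  have h1' : v 1 = 0 := Complex.normSq_eq_zero.1 (by linarith)
  funext i
  fin_cases i
  · exact h0'
  · exact h1'

theorem mulVec_smul_add_smul_quatJ (A : Matrix (Fin 2) (Fin 2) ℂ) (c a : ℂ) (v : Fin 2 → ℂ) :
    A.mulVec (c • (v + a • quatJ v)) = c • (A.mulVec v + a • A.mulVec (quatJ v)) := by
  rw [Matrix.mulVec_smul, Matrix.mulVec_add, Matrix.mulVec_smul]

theorem mulVec_quatJ_smul_add_smul_quatJ (A : Matrix (Fin 2) (Fin 2) ℂ) (c a : ℂ)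
    (v : Fin 2 → ℂ) : A.mulVec (quatJ (c • (v + a • quatJ v))) =
      star c • (A.mulVec (quatJ v) + (-star a) • A.mulVec v) := by
  rw [quatJ_smul, quatJ_add_smul_quatJ, Matrix.mulVec_smul, Matrix.mulVec_add, Matrix.mulVec_smul]

/-- Three points in the normal form of an equilateral triangle. -/
theorem exists_isTauLift_three (v : Fin 3 → Fin 2 → ℂ) (hv : ∀ i, v i ≠ 0) {a b c₁ c₂ : ℂ}
    (h₁ : v 1 = c₁ • (v 0 + a • quatJ (v 0))) (h₂ : v 2 = c₂ • (v 0 + b • quatJ (v 0)))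
    (hsum : a + b = 0) (ha : a * star a = 3) :
    ∃ Φ m, IsTauLift (fun i => Projectivization.mk ℂ (v i) (hv i)) Φ m := by
  refine ⟨_, 3, isTauLift_of_antipodal v hv differentiable_cubicCovariant cubicCovariant_smul
    fun A => ?_⟩
  obtain rfl : b = -a := by linear_combination hsum
  have hc₁ : c₁ ≠ 0 := by rintro rfl; exact hv 1 (by rw [h₁, zero_smul])
  have hc₂ : c₂ ≠ 0 := by rintro rfl; exact hv 2 (by rw [h₂, zero_smul])
  set l := (A : Matrix (Fin 2) (Fin 2) ℂ).mulVec (v 0) with hl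
  set m := (A : Matrix (Fin 2) (Fin 2) ℂ).mulVec (quatJ (v 0)) with hm
  have ha0 : a ≠ 0 := by rintro rfl; simp at ha
  have e1 : (fun i => (A : Matrix (Fin 2) (Fin 2) ℂ).mulVec (v i)) =
      fun i => (![1, c₁, c₂] : Fin 3 → ℂ) i • (![l, l + a • m, l + (-a) • m]) i := by
    funext i
    fin_cases i
    · exact (one_smul _ _).symm
    · exact (congrArg _ h₁).trans (mulVec_smul_add_smul_quatJ _ _ _ _)
    · exact (congrArg _ h₂).trans (mulVec_smul_add_smul_quatJ _ _ _ _)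
  have e2 : (fun i => (A : Matrix (Fin 2) (Fin 2) ℂ).mulVec (quatJ (v i))) =
      fun i => (![1, star c₁, star c₂] : Fin 3 → ℂ) i •
        (![m, m + (-star a) • l, m + (-star (-a)) • l]) i := by
    funext i
    fin_cases i
    · exact (one_smul _ _).symm
    · exact (congrArg (fun x => Matrix.mulVec _ (quatJ x)) h₁).trans
        (mulVec_quatJ_smul_add_smul_quatJ _ _ _ _)
    · exact (congrArg (fun x => Matrix.mulVec _ (quatJ x)) h₂).trans
        (mulVec_quatJ_smul_add_smul_quatJ _ _ _ _)
  -- The factors are the cubic homogeneity applied to the scalars of the vertices, the constant of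
  -- the normal form, and the inverse of the conjugate scalars of the antipodes.
  refine ⟨(c₁ * c₂) ^ 3 * (2 * (a ^ 2) ^ 3 * (l 0 * m 1 - l 1 * m 0) ^ 3) *
    (star c₁ * star c₂)⁻¹, ?_, ?_⟩
  · have := det_mulVec_quatJ_ne_zero A (hv 0)
    simp only [← hl, ← hm] at this
    simp [hc₁, hc₂, ha0, this]
  · rw [e1, e2, formCoords_smul, formCoords_smul, formCoords_cubic,
      show -star (-a) = -(-star a) by rw [star_neg], formCoords_cubic,
      cubicCovariant_smul, cubicCovariant_normalForm l m (c' := (-star a) ^ 2)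
        (by linear_combination (a * star a + 3) * ha), smul_smul, smul_smul]
    congr 1
    have : (starRingEnd ℂ) c₁ ≠ 0 := star_ne_zero.2 hc₁
    have : (starRingEnd ℂ) c₂ ≠ 0 := star_ne_zero.2 hc₂
    simp only [Fin.prod_univ_three]
    simp
    field_simp

/-- Four points in the normal form of a regular tetrahedron. -/
theorem exists_isTauLift_four (v : Fin 4 → Fin 2 → ℂ) (hv : ∀ i, v i ≠ 0) {a b c c₁ c₂ c₃ : ℂ}
    (h₁ : v 1 = c₁ • (v 0 + a • quatJ (v 0))) (h₂ : v 2 = c₂ • (v 0 + b • quatJ (v 0)))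
    (h₃ : v 3 = c₃ • (v 0 + c • quatJ (v 0)))
    (hsum : a + b + c = 0) (ha : a * star a = 2) (hb : b * star b = 2) (hc : c * star c = 2) :
    ∃ Φ m, IsTauLift (fun i => Projectivization.mk ℂ (v i) (hv i)) Φ m := by
  refine ⟨_, 2, isTauLift_of_antipodal v hv differentiable_quarticHessian quarticHessian_smul
    fun A => ?_⟩
  have hc₁ : c₁ ≠ 0 := by rintro rfl; exact hv 1 (by rw [h₁, zero_smul])
  have hc₂ : c₂ ≠ 0 := by rintro rfl; exact hv 2 (by rw [h₂, zero_smul])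
  have hc₃ : c₃ ≠ 0 := by rintro rfl; exact hv 3 (by rw [h₃, zero_smul])
  set l := (A : Matrix (Fin 2) (Fin 2) ℂ).mulVec (v 0) with hl
  set m := (A : Matrix (Fin 2) (Fin 2) ℂ).mulVec (quatJ (v 0)) with hm
  have ha0 : a ≠ 0 := by rintro rfl; simp at ha
  have hb0 : b ≠ 0 := by rintro rfl; simp at hb
  have hc0 : c ≠ 0 := by rintro rfl; simp at hc
  have hsum' : star a + star b + star c = 0 := by
    rw [← star_add, ← star_add, hsum, star_zero]
  -- Since `1 / a = conj a / 2` and likewise for `b, c`, the sum is `(abc / 2) · conj (a + b + c)`.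
  have he2 : a * b + a * c + b * c = 0 := by
    linear_combination (a * b * c / 2) * hsum' - (b * c / 2) * ha - (a * c / 2) * hb -
      (a * b / 2) * hc
  have he2' : -star a * -star b + -star a * -star c + -star b * -star c = 0 := by
    have := congrArg star he2
    simp only [star_add, star_mul, star_zero] at this
    linear_combination this
  have e1 : (fun i => (A : Matrix (Fin 2) (Fin 2) ℂ).mulVec (v i)) =
      fun i => (![1, c₁, c₂, c₃] : Fin 4 → ℂ) i •
        (![l, l + a • m, l + b • m, l + c • m]) i := by
    funext i
    fin_cases i
    · exact (one_smul _ _).symm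
    · exact (congrArg _ h₁).trans (mulVec_smul_add_smul_quatJ _ _ _ _)
    · exact (congrArg _ h₂).trans (mulVec_smul_add_smul_quatJ _ _ _ _)
    · exact (congrArg _ h₃).trans (mulVec_smul_add_smul_quatJ _ _ _ _)
  have e2 : (fun i => (A : Matrix (Fin 2) (Fin 2) ℂ).mulVec (quatJ (v i))) =
      fun i => (![1, star c₁, star c₂, star c₃] : Fin 4 → ℂ) i •
        (![m, m + (-star a) • l, m + (-star b) • l, m + (-star c) • l]) i := by
    funext i
    fin_cases i
    · exact (one_smul _ _).symm
    · exact (congrArg (fun x => Matrix.mulVec _ (quatJ x)) h₁).trans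
        (mulVec_quatJ_smul_add_smul_quatJ _ _ _ _)
    · exact (congrArg (fun x => Matrix.mulVec _ (quatJ x)) h₂).trans
        (mulVec_quatJ_smul_add_smul_quatJ _ _ _ _)
    · exact (congrArg (fun x => Matrix.mulVec _ (quatJ x)) h₃).trans
        (mulVec_quatJ_smul_add_smul_quatJ _ _ _ _)
  refine ⟨(c₁ * c₂ * c₃) ^ 2 * (-9 * (a * b * c) ^ 2 * (l 0 * m 1 - l 1 * m 0) ^ 2) *
    (star c₁ * star c₂ * star c₃)⁻¹, ?_, ?_⟩
  · have := det_mulVec_quatJ_ne_zero A (hv 0)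
    simp only [← hl, ← hm] at this
    simp [hc₁, hc₂, hc₃, ha0, hb0, hc0, this]
  · rw [e1, e2, formCoords_smul, formCoords_smul, formCoords_quartic l m hsum he2,
      formCoords_quartic m l (by linear_combination -hsum') he2',
      quarticHessian_smul, quarticHessian_normalForm l m (e' := star a * star b * star c)
        (by linear_combination (b * star b * c * star c) * ha + 2 * c * star c * hb + 4 * hc),
      smul_smul, smul_smul]
    have h1 : (starRingEnd ℂ) c₁ ≠ 0 := star_ne_zero.2 hc₁
    have h2 : (starRingEnd ℂ) c₂ ≠ 0 := star_ne_zero.2 hc₂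
    have h3 : (starRingEnd ℂ) c₃ ≠ 0 := star_ne_zero.2 hc₃
    rw [show -(star a * star b * star c) = -star a * -star b * -star c by ring]
    congr 1
    simp only [Fin.prod_univ_four]
    simp
    field_simp

/-! ## Stereographic projection in homogeneous coordinates -/

theorem sum_sq_eq_one {p : EuclideanSpace ℝ (Fin 3)} (hp : ‖p‖ = 1) :
    p 0 ^ 2 + p 1 ^ 2 + p 2 ^ 2 = 1 := by
  have := EuclideanSpace.norm_sq_eq p
  rw [hp, Fin.sum_univ_three] at this
  simpa using this.symm

theorem sum_sq_eq_one_complex {p : EuclideanSpace ℝ (Fin 3)} (hp : ‖p‖ = 1) :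
    (p 0 : ℂ) ^ 2 + (p 1 : ℂ) ^ 2 + (p 2 : ℂ) ^ 2 = 1 := by
  have := congrArg Complex.ofReal (sum_sq_eq_one hp)
  push_cast at this
  exact this

/-- The Hermitian matrix of the line that corresponds to a point of the unit sphere. -/
theorem exists_stereoVec_mul_star {p : EuclideanSpace ℝ (Fin 3)} (hp : ‖p‖ = 1) :
    ∃ N : ℂ, N ≠ 0 ∧ star N = N ∧
      stereoVec p 0 * star (stereoVec p 0) = N / 2 * (1 + p 2) ∧
      stereoVec p 0 * star (stereoVec p 1) = N / 2 * (p 0 + Complex.I * p 1) ∧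
      stereoVec p 1 * star (stereoVec p 0) = N / 2 * (p 0 - Complex.I * p 1) ∧
      stereoVec p 1 * star (stereoVec p 1) = N / 2 * (1 - p 2) := by
  have hsq := sum_sq_eq_one hp
  by_cases h : p 2 = 1
  · have h0 : p 0 = 0 := by nlinarith
    have h1 : p 1 = 0 := by nlinarith
    refine ⟨1, one_ne_zero, star_one _, ?_⟩
    simp [stereoVec, h, h0, h1]
    norm_num
  · have hsq' : (p 0 : ℂ) ^ 2 + (p 1 : ℂ) ^ 2 + (p 2 : ℂ) ^ 2 = 1 :=
      sum_sq_eq_one_complex hp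
    -- `N` is the squared length of `stereoVec p`: `|p 0 + i p 1|² + (1 - p 2)² = 2 (1 - p 2)` on
    -- the unit sphere.
    refine ⟨((2 * (1 - p 2) : ℝ) : ℂ), ?_, ?_, ?_⟩
    · rw [Complex.ofReal_ne_zero]
      exact mul_ne_zero two_ne_zero (sub_ne_zero.2 (Ne.symm h))
    · exact Complex.conj_ofReal _
    · simp [stereoVec, h]
      refine ⟨?_, ?_, ?_⟩
      · linear_combination hsq' - (p 1 : ℂ) ^ 2 * Complex.I_sq
      · ring
      · left; ring

/-- Stereographic projection carries the antipodal map to `J`. The poles are separate cases because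
`stereoVec` is normalised differently at `(0, 0, 1)`. -/
theorem exists_stereoVec_neg {p : EuclideanSpace ℝ (Fin 3)} (hp : ‖p‖ = 1) :
    ∃ c : ℂ, c ≠ 0 ∧ stereoVec (-p) = c • quatJ (stereoVec p) := by
  have hsq := sum_sq_eq_one hp
  suffices h : ∃ c : ℂ, stereoVec (-p) = c • quatJ (stereoVec p) by
    obtain ⟨c, hc⟩ := h
    refine ⟨c, ?_, hc⟩
    rintro rfl
    exact stereoVec_ne_zero (-p) (by rw [hc, zero_smul])
  by_cases h : p 2 = 1
  · have h0 : p 0 = 0 := by nlinarith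
    have h1 : p 1 = 0 := by nlinarith
    refine ⟨2, ?_⟩
    have h' : ¬ (-1 : ℝ) = 1 := by norm_num
    funext i
    fin_cases i <;> simp [stereoVec, quatJ, h, h0, h1, h']
    norm_num
  · have h1 : (1 : ℂ) - p 2 ≠ 0 := by
      rw [sub_ne_zero]; exact_mod_cast Ne.symm h
    by_cases h' : p 2 = -1
    · have h0 : p 0 = 0 := by nlinarith
      have h1 : p 1 = 0 := by nlinarith
      refine ⟨-1 / 2, ?_⟩
      have h' : ¬ (-1 : ℝ) = 1 := by norm_num
      funext i
      fin_cases i <;> simp [stereoVec, quatJ, *]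
      norm_num
    · have h'' : ¬ -p 2 = 1 := fun h => h' (by linarith)
      refine ⟨(p 0 + Complex.I * p 1) / (1 - p 2), ?_⟩
      have hsq' : (p 0 : ℂ) ^ 2 + (p 1 : ℂ) ^ 2 + (p 2 : ℂ) ^ 2 = 1 :=
      sum_sq_eq_one_complex hp
      funext i
      fin_cases i
      · simp [stereoVec, quatJ, h, h'']
        field_simp
        ring
      · simp [stereoVec, quatJ, h, h'']
        field_simp
        linear_combination -hsq' + (p 1 : ℂ) ^ 2 * Complex.I_sq

theorem inner_eq_sum {p q : EuclideanSpace ℝ (Fin 3)} :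
    inner ℝ p q = p 0 * q 0 + p 1 * q 1 + p 2 * q 2 := by
  simp [PiLp.inner_apply, Fin.sum_univ_three]
  ring

/-- Points of the unit sphere at a fixed distance from `p`, in the unitary frame of `ℂ²` given
by `p`. -/
theorem exists_stereoVec_decomposition {p : EuclideanSpace ℝ (Fin 3)} (hp : ‖p‖ = 1) {κ : ℝ}
    (hκ : 1 + κ ≠ 0) :
    ∃ Λ : EuclideanSpace ℝ (Fin 3) →+ ℂ, Λ p = 0 ∧
      ∀ q : EuclideanSpace ℝ (Fin 3), ‖q‖ = 1 → inner ℝ p q = κ →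
        (∃ c : ℂ, stereoVec q = c • (stereoVec p + Λ q • quatJ (stereoVec p))) ∧
        Λ q * star (Λ q) = ((1 - κ) / (1 + κ) : ℝ) := by
  obtain ⟨N, hN, -, s00, s01, s10, s11⟩ := exists_stereoVec_mul_star hp
  set s0 := stereoVec p 0 with hs0
  set s1 := stereoVec p 1 with hs1
  have hκ' : (1 : ℂ) + κ ≠ 0 := by exact_mod_cast hκ
  -- The coefficient is `β / α = β ᾱ / |α|²`, with `α` and `β` the Hermitian product and the
  -- determinant of the vectors of `p` and `q`. At fixed `⟨p, q⟩ = κ`, `|α|²` is `(1 + κ) / 2` times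
  -- the squared lengths and `β ᾱ` is linear in `q` up to the same scale `M`, which cancels.
  -- Additivity then turns a relation between vertices into one between coefficients.
  refine ⟨AddMonoidHom.mk' (fun q => (s0 ^ 2 * (q 0 - Complex.I * q 1) -
    s1 ^ 2 * (q 0 + Complex.I * q 1) - 2 * s0 * s1 * q 2) / (N * (1 + κ))) ?_, ?_, ?_⟩
  · intro x y
    simp
    ring
  · simp only [AddMonoidHom.mk'_apply]
    rw [div_eq_zero_iff]
    left
    have : N / 2 * (s0 ^ 2 * (p 0 - Complex.I * p 1) -
      s1 ^ 2 * (p 0 + Complex.I * p 1) - 2 * s0 * s1 * p 2) = 0 := by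
      linear_combination -s0 ^ 2 * s10 + s1 ^ 2 * s01 + s0 * s1 * s00 - s0 * s1 * s11
    exact (mul_eq_zero.1 this).resolve_left (div_ne_zero hN two_ne_zero)
  · intro q hq hpq
    obtain ⟨M, hM, -, v00, v01, v10, v11⟩ := exists_stereoVec_mul_star hq
    simp only [AddMonoidHom.mk'_apply]
    set v0 := stereoVec q 0 with hv0
    set v1 := stereoVec q 1 with hv1
    set L : ℂ := s0 ^ 2 * (q 0 - Complex.I * q 1) -
      s1 ^ 2 * (q 0 + Complex.I * q 1) - 2 * s0 * s1 * q 2 with hL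
    have hpq' : (p 0 : ℂ) * q 0 + p 1 * q 1 + p 2 * q 2 = κ := by
      rw [← hpq, inner_eq_sum]; push_cast; ring
    set α := star s0 * v0 + star s1 * v1 with hα
    set β := s0 * v1 - s1 * v0 with hβ
    have hαs : star α = s0 * star v0 + s1 * star v1 := by simp [hα]
    have hβs : star β = star s0 * star v1 - star s1 * star v0 := by simp [hβ]
    have hαα : α * star α = N * M / 2 * (1 + κ) := by
      rw [hαs, hα]
      have : (star s0 * v0 + star s1 * v1) * (s0 * star v0 + s1 * star v1) =
          (s0 * star s0) * (v0 * star v0) + (s1 * star s0) * (v0 * star v1) +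
          (s0 * star s1) * (v1 * star v0) + (s1 * star s1) * (v1 * star v1) := by ring
      rw [this, s00, s01, s10, s11, v00, v01, v10, v11]
      linear_combination (N * M / 2) * hpq' - (N * M / 2 * p 1 * q 1) * Complex.I_sq
    have hββ : β * star β = N * M / 2 * (1 - κ) := by
      rw [hβs, hβ]
      have : (s0 * v1 - s1 * v0) * (star s0 * star v1 - star s1 * star v0) =
          (s0 * star s0) * (v1 * star v1) - (s0 * star s1) * (v1 * star v0) -
          (s1 * star s0) * (v0 * star v1) + (s1 * star s1) * (v0 * star v0) := by ring
      rw [this, s00, s01, s10, s11, v00, v01, v10, v11]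
      linear_combination -(N * M / 2) * hpq' + (N * M / 2 * p 1 * q 1) * Complex.I_sq
    have hβα : β * star α = M / 2 * L := by
      rw [hαs, hβ, hL]
      linear_combination s0 ^ 2 * v10 - s1 ^ 2 * v01 + s0 * s1 * v11 - s0 * s1 * v00
    have hαs0 : star α ≠ 0 := by
      intro h0
      rw [h0, mul_zero] at hαα
      have : N * M / 2 * (1 + κ) ≠ 0 :=
        mul_ne_zero (div_ne_zero (mul_ne_zero hN hM) two_ne_zero) hκ'
      exact this hαα.symm
    have hα0 : α ≠ 0 := fun h0 => hαs0 (by rw [h0, star_zero])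
    have hNs : N = s0 * star s0 + s1 * star s1 := by rw [s00, s11]; ring
    have hρ : α * (L / (N * (1 + κ))) = β := by
      apply mul_right_cancel₀ hαs0
      rw [hβα]
      calc α * (L / (N * (1 + κ))) * star α = (α * star α) * (L / (N * (1 + κ))) := by ring
        _ = M / 2 * L := by rw [hαα]; field_simp
    set ρ := L / (N * (1 + κ)) with hρ'
    refine ⟨⟨α / N, ?_⟩, ?_⟩
    · have key : N • stereoVec q = α • stereoVec p + β • quatJ (stereoVec p) := by
        funext i
        fin_cases i
        · simp [quatJ, ← hs0, ← hs1, ← hv0]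
          rw [hNs, hα, hβ]; simp; ring
        · simp [quatJ, ← hs0, ← hs1, ← hv1]
          rw [hNs, hα, hβ]; simp; ring
      rw [← hρ] at key
      calc stereoVec q = N⁻¹ • (N • stereoVec q) := by rw [smul_smul, inv_mul_cancel₀ hN, one_smul]
        _ = _ := by
          rw [key, smul_add, smul_add, smul_smul, smul_smul, smul_smul]
          congr 2 <;> ring
    · apply mul_left_cancel₀ (mul_ne_zero hα0 hαs0)
      have : α * star α * (ρ * star ρ) = (α * ρ) * star (α * ρ) := by rw [star_mul]; ring
      rw [this, hρ, hββ, hαα]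
      push_cast
      field_simp

/-! ## The four shapes -/

theorem norm_rawVertex_triangle (i : Fin 3) : ‖Shape.rawVertex .triangle i‖ = 2 := by
  rw [EuclideanSpace.norm_eq, Real.sqrt_eq_iff_mul_self_eq (by positivity) (by norm_num)]
  fin_cases i <;> simp [Shape.rawVertex, Fin.sum_univ_three] <;> norm_num

theorem norm_rawVertex_tetrahedron (i : Fin 4) : ‖Shape.rawVertex .tetrahedron i‖ = √3 := by
  rw [EuclideanSpace.norm_eq]
  congr 1
  fin_cases i <;> simp [Shape.rawVertex, Fin.sum_univ_three] <;> norm_num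

theorem norm_map_inv_norm_smul {E : Type*} [NormedAddCommGroup E] [NormedSpace ℝ E]
    (g : E ≃ₗᵢ[ℝ] E) {x : E} (hx : ‖x‖ ≠ 0) : ‖g (‖x‖⁻¹ • x)‖ = 1 := by
  rw [g.norm_map, norm_smul, norm_inv, norm_norm, inv_mul_cancel₀ hx]

theorem inner_map_inv_norm_smul {E : Type*} [NormedAddCommGroup E] [InnerProductSpace ℝ E]
    (g : E ≃ₗᵢ[ℝ] E) {x y : E} {c κ : ℝ} (hc : c ≠ 0) (hx : ‖x‖ = c) (hy : ‖y‖ = c)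
    (h : inner ℝ x y = κ * c ^ 2) : inner ℝ (g (‖x‖⁻¹ • x)) (g (‖y‖⁻¹ • y)) = κ := by
  rw [g.inner_map_map, real_inner_smul_left, real_inner_smul_right, hx, hy, h]
  field_simp

/-- Equilateral triangles, centred at the origin. -/
theorem exists_isTauLift_of_triangle (r : Fin 3 → EuclideanSpace ℝ (Fin 3)) {c : ℝ} (hc : c ≠ 0)
    (hr : ∀ i, ‖r i‖ = c) (hin : ∀ i, i ≠ 0 → inner ℝ (r 0) (r i) = -1 / 2 * c ^ 2)
    (hsum : r 1 + r 2 = -r 0)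
    (g : EuclideanSpace ℝ (Fin 3) ≃ₗᵢ[ℝ] EuclideanSpace ℝ (Fin 3)) :
    ∃ Φ m, IsTauLift (fun i => stereo (g (‖r i‖⁻¹ • r i))) Φ m := by
  have hn : ∀ i, ‖g (‖r i‖⁻¹ • r i)‖ = 1 := fun i =>
    norm_map_inv_norm_smul g (by rwa [hr])
  have hin' : ∀ i, i ≠ 0 → inner ℝ (g (‖r 0‖⁻¹ • r 0)) (g (‖r i‖⁻¹ • r i)) = -1 / 2 := fun i hi =>
    inner_map_inv_norm_smul g hc (hr 0) (hr i) (hin i hi)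
  have hsum' : g (‖r 1‖⁻¹ • r 1) + g (‖r 2‖⁻¹ • r 2) = -g (‖r 0‖⁻¹ • r 0) := by
    rw [← map_add, ← map_neg, hr, hr, hr, ← smul_add, hsum, smul_neg]
  -- Here `(1 - κ) / (1 + κ) = 3`. The coefficients sum to `-Λ p = 0` because the vertices sum to
  -- zero.
  obtain ⟨Λ, h0, hΛ⟩ := exists_stereoVec_decomposition (hn 0) (κ := -1 / 2) (by norm_num)
  obtain ⟨⟨c₁, h₁⟩, ha⟩ := hΛ _ (hn 1) (hin' 1 (by decide))
  obtain ⟨⟨c₂, h₂⟩, -⟩ := hΛ _ (hn 2) (hin' 2 (by decide))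
  exact exists_isTauLift_three (fun i => stereoVec (g (‖r i‖⁻¹ • r i)))
    (fun i => stereoVec_ne_zero _) h₁ h₂
    (by rw [← map_add, hsum', map_neg, h0, neg_zero]) (by rw [ha]; norm_num)

/-- Regular tetrahedra, centred at the origin. -/
theorem exists_isTauLift_of_tetrahedron (r : Fin 4 → EuclideanSpace ℝ (Fin 3)) {c : ℝ}
    (hc : c ≠ 0) (hr : ∀ i, ‖r i‖ = c)
    (hin : ∀ i, i ≠ 0 → inner ℝ (r 0) (r i) = -1 / 3 * c ^ 2) (hsum : r 1 + r 2 + r 3 = -r 0)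
    (g : EuclideanSpace ℝ (Fin 3) ≃ₗᵢ[ℝ] EuclideanSpace ℝ (Fin 3)) :
    ∃ Φ m, IsTauLift (fun i => stereo (g (‖r i‖⁻¹ • r i))) Φ m := by
  have hn : ∀ i, ‖g (‖r i‖⁻¹ • r i)‖ = 1 := fun i =>
    norm_map_inv_norm_smul g (by rwa [hr])
  have hin' : ∀ i, i ≠ 0 → inner ℝ (g (‖r 0‖⁻¹ • r 0)) (g (‖r i‖⁻¹ • r i)) = -1 / 3 := fun i hi =>
    inner_map_inv_norm_smul g hc (hr 0) (hr i) (hin i hi)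
  have hsum' : g (‖r 1‖⁻¹ • r 1) + g (‖r 2‖⁻¹ • r 2) + g (‖r 3‖⁻¹ • r 3) =
      -g (‖r 0‖⁻¹ • r 0) := by
    rw [← map_add, ← map_add, ← map_neg, hr, hr, hr, hr, ← smul_add, ← smul_add, hsum, smul_neg]
  -- Here `(1 - κ) / (1 + κ) = 2`.
  obtain ⟨Λ, h0, hΛ⟩ := exists_stereoVec_decomposition (hn 0) (κ := -1 / 3) (by norm_num)
  obtain ⟨⟨c₁, h₁⟩, ha⟩ := hΛ _ (hn 1) (hin' 1 (by decide))
  obtain ⟨⟨c₂, h₂⟩, hb⟩ := hΛ _ (hn 2) (hin' 2 (by decide))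
  obtain ⟨⟨c₃, h₃⟩, hc⟩ := hΛ _ (hn 3) (hin' 3 (by decide))
  exact exists_isTauLift_four (fun i => stereoVec (g (‖r i‖⁻¹ • r i)))
    (fun i => stereoVec_ne_zero _) h₁ h₂ h₃
    (by rw [← map_add, ← map_add, hsum', map_neg, h0, neg_zero])
    (by rw [ha]; norm_num) (by rw [hb]; norm_num) (by rw [hc]; norm_num)

theorem exists_isTauLift_triangle (g : EuclideanSpace ℝ (Fin 3) ≃ₗᵢ[ℝ] EuclideanSpace ℝ (Fin 3)) :
    ∃ Φ m, IsTauLift (config .triangle g) Φ m := by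
  refine exists_isTauLift_of_triangle (Shape.rawVertex .triangle) two_ne_zero
    norm_rawVertex_triangle (fun i hi => ?_) ?_ g
  · rw [inner_eq_sum]
    fin_cases i
    · exact absurd rfl hi
    · simp [Shape.rawVertex]; norm_num
    · simp [Shape.rawVertex]; norm_num
  · ext i
    fin_cases i <;> simp [Shape.rawVertex]
    norm_num

theorem exists_isTauLift_tetrahedron
    (g : EuclideanSpace ℝ (Fin 3) ≃ₗᵢ[ℝ] EuclideanSpace ℝ (Fin 3)) :
    ∃ Φ m, IsTauLift (config .tetrahedron g) Φ m := by
  refine exists_isTauLift_of_tetrahedron (Shape.rawVertex .tetrahedron) (c := √3)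
    (by norm_num) norm_rawVertex_tetrahedron (fun i hi => ?_) ?_ g
  · rw [inner_eq_sum, Real.sq_sqrt (by norm_num)]
    fin_cases i
    · exact absurd rfl hi
    · simp [Shape.rawVertex]
    · simp [Shape.rawVertex]
    · simp [Shape.rawVertex]
  · ext i
    fin_cases i <;> simp [Shape.rawVertex]

theorem exists_isTauLift_of_rawVertex_neg {s : Shape} {σ : Fin s.card → Fin s.card}
    (hσ : Function.Involutive σ) (h : ∀ i, s.rawVertex (σ i) = -s.rawVertex i)
    (h0 : ∀ i, s.rawVertex i ≠ 0)
    (g : EuclideanSpace ℝ (Fin 3) ≃ₗᵢ[ℝ] EuclideanSpace ℝ (Fin 3)) :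
    ∃ Φ m, IsTauLift (config s g) Φ m := by
  refine exists_isTauLift_of_centrallySymmetric (fun i => stereoVec (g (s.vertex i)))
    (fun i => stereoVec_ne_zero _) hσ fun i => ?_
  have : g (s.vertex (σ i)) = -g (s.vertex i) := by
    rw [Shape.vertex, Shape.vertex, h, norm_neg, smul_neg, map_neg]
  rw [this]
  exact exists_stereoVec_neg (norm_map_inv_norm_smul g (norm_ne_zero_iff.2 (h0 i)))

theorem exists_isTauLift_octahedron
    (g : EuclideanSpace ℝ (Fin 3) ≃ₗᵢ[ℝ] EuclideanSpace ℝ (Fin 3)) :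
    ∃ Φ m, IsTauLift (config .octahedron g) Φ m := by
  refine exists_isTauLift_of_rawVertex_neg (s := .octahedron)
    (σ := (![1, 0, 3, 2, 5, 4] : Fin 6 → Fin 6)) ?_ ?_ ?_ g
  · change ∀ i : Fin 6, (![1, 0, 3, 2, 5, 4] : Fin 6 → Fin 6)
      ((![1, 0, 3, 2, 5, 4] : Fin 6 → Fin 6) i) = i
    decide
  · change ∀ i : Fin 6, _
    intro i
    ext j
    fin_cases i <;> fin_cases j <;> simp [Shape.rawVertex]
  · change ∀ i : Fin 6, _
    intro i hi
    have h0 := congrArg (fun p => p 0) hi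
    have h1 := congrArg (fun p => p 1) hi
    have h2 := congrArg (fun p => p 2) hi
    fin_cases i <;> simp [Shape.rawVertex] at h0 h1 h2

theorem exists_isTauLift_icosahedron
    (g : EuclideanSpace ℝ (Fin 3) ≃ₗᵢ[ℝ] EuclideanSpace ℝ (Fin 3)) :
    ∃ Φ m, IsTauLift (config .icosahedron g) Φ m := by
  refine exists_isTauLift_of_rawVertex_neg (s := .icosahedron)
    -- Reversing each block of four in the list of vertices is negation.
    (σ := (![3, 2, 1, 0, 7, 6, 5, 4, 11, 10, 9, 8] : Fin 12 → Fin 12)) ?_ ?_ ?_ g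
  · change ∀ i : Fin 12, (![3, 2, 1, 0, 7, 6, 5, 4, 11, 10, 9, 8] : Fin 12 → Fin 12)
      ((![3, 2, 1, 0, 7, 6, 5, 4, 11, 10, 9, 8] : Fin 12 → Fin 12) i) = i
    decide
  · change ∀ i : Fin 12, _
    intro i
    ext j
    fin_cases i <;> fin_cases j <;> simp [Shape.rawVertex]
  · change ∀ i : Fin 12, _
    intro i hi
    have h0 := congrArg (fun p => p 0) hi
    have h1 := congrArg (fun p => p 1) hi
    have h2 := congrArg (fun p => p 2) hi
    fin_cases i <;> simp [Shape.rawVertex] at h0 h1 h2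

theorem exists_isTauLift (s : Shape)
    (g : EuclideanSpace ℝ (Fin 3) ≃ₗᵢ[ℝ] EuclideanSpace ℝ (Fin 3)) :
    ∃ Φ m, IsTauLift (config s g) Φ m := by
  cases s
  · exact exists_isTauLift_triangle g
  · exact exists_isTauLift_tetrahedron g
  · exact exists_isTauLift_octahedron g
  · exact exists_isTauLift_icosahedron g

end PlatonicLagrangian

end

open PlatonicLagrangian in
theorem mainTheorem11 (s : Shape)
    (g : EuclideanSpace ℝ (Fin 3) ≃ₗᵢ[ℝ] EuclideanSpace ℝ (Fin 3)) :
    -- `τ` is given by `A · C ↦ A^‡ · C`, whatever the choice of `A`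
    (∀ A : Matrix.SpecialLinearGroup (Fin 2) ℂ,
      tau (config s g) (orbitPoint (config s g) A) = orbitPoint (config s g) (ddag A)) ∧
    -- extension of `τ ∘ u` over the puncture
    (∀ U : Set ℂ, IsOpen U → (0 : ℂ) ∈ U →
      ∀ u : ℂ → ℙ ℂ (Fin (s.card + 1) → ℂ),
        HolomorphicOnOpen u U → Set.MapsTo u U (orbitClosure (config s g)) →
        Set.MapsTo u (U \ {0}) (openOrbit (config s g)) →
        ∃ v : ℂ → ℙ ℂ (Fin (s.card + 1) → ℂ), ContinuousOn v U ∧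
          Set.MapsTo v U (orbitClosure (config s g)) ∧
          Set.EqOn v (tau (config s g) ∘ u) (U \ {0})) ∧
    -- doubling of holomorphic discs to holomorphic spheres
    (∀ u : ℂ → ℙ ℂ (Fin (s.card + 1) → ℂ), IsHolomorphicDisc (config s g) u →
      ∃ w : OnePoint ℂ → ℙ ℂ (Fin (s.card + 1) → ℂ), HolomorphicSphere w ∧
        (∀ x, w x ∈ orbitClosure (config s g)) ∧
        (∀ z ∈ Metric.closedBall (0 : ℂ) 1, w (z : OnePoint ℂ) = u z) ∧
        (∀ z ∈ Metric.closedBall (0 : ℂ) 1, u z ∈ openOrbit (config s g) →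
          w (reflect z) = tau (config s g) (u z))) := by
  obtain ⟨Φ, m, h⟩ := exists_isTauLift s g
  exact ⟨h.tau_orbitPoint,
    fun U hU hU0 u hu _ huW => h.exists_continuousOn_extension hU hU0 hu huW,
    fun u hu => h.exists_double hu⟩
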